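/- Let $k$ be an algebraically closed field of characteristic zero. By a variety we mean an algebraic variety over $k$ (a reduced separated scheme of finite type over $k$, not necessarily irreducible); its points are its closed points, and ${\rm Aut}(X)$ is the group of automorphisms of $X$ over $k$. A group $G$ is called Jordan if there is a positive integer $d$ such that every finite subgroup $K$ of $G$ contains a normal abelian subgroup whose index in $K$ is at most $d$; the minimal such $d$ is denoted by $J_G$. For a point $x$ of $X$, let $\mathcal O_{x,X}$ be its local ring and ${\rm T}_{x,X}$ the Zariski tangent space. The variety $X$ is smooth at $x$ if $\dim {\rm T}_{x,X}=\dim\mathcal O_{x,X}$, otherwise $x$ is singular; $X$ is smooth if it is smooth at all its points. (1) Let $X$ be an irreducible variety and let $\sim$ be an equivalence relation on the set of points of $X$ that is ${\rm Aut}(X)$-stable, i.e. every equivalence class of $\sim$ is mapped to itself by every element of ${\rm Aut}(X)$ (equivalently, $g\cdot x\sim x$ for all $g\in{\rm Aut}(X)$ and $x\in X$). If there is a finite equivalence class $C$ of $\sim$, then ${\rm Aut}(X)$ is Jordan, the maximum $m=\max_{x}\dim {\rm T}_{x,X}$ over the points $x$ of $X$ exists, and $$J_{{\rm Aut}(X)}\leqslant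 |C|!\; J_{{\bf GL}_m(k)}^{\,|C|!}.$$ (2) If an irreducible variety $X$ has a point $x$ such that the set $\{y\in X\mid \mathcal O_{x,X}\text{ and }\mathcal O_{y,X}\text{ are isomorphic as } k\text{-algebras}\}$ is finite, then ${\rm Aut}(X)$ is Jordan. (3) Call a point $x$ of $X$ a vertex if $\dim {\rm T}_{x,X}\geqslant\dim {\rm T}_{y,X}$ for every point $y$ of $X$. The automorphism group of every irreducible variety with only finitely many vertices is Jordan. (4) The automorphism group of every nonsmooth irreducible variety with only finitely many singular points is Jordan. (5) Let $Z$ be a smooth irreducible closed subvariety of ${\bf P}^{n-1}$, $Z\neq{\bf P}^{n-1}$, that does not lie in any hyperplane, and let $X\subset{\bf A}^n$ be its affine cone, i.e. the closed subvariety defined by the homogeneous ideal $I(Z)\subset k[x_1,\dots,x_n]$. Then ${\rm Aut}(X)$ is Jordan. -/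

import Mathlib

open CategoryTheory AlgebraicGeometry

universe u

noncomputable section

/-! ### Jordan groups -/

/-- Every finite subgroup `K` of `G` has a normal abelian subgroup of index at most `d` in `K`. -/
def IsJordanBound (G : Type*) [Group G] (d : ℕ) : Prop :=
  ∀ K : Subgroup G, Finite K →
    ∃ A : Subgroup K, A.Normal ∧ IsMulCommutative A ∧ A.index ≤ d

/-- Jordan groups. -/
def IsJordanGroup (G : Type*) [Group G] : Prop :=
  ∃ d : ℕ, 0 < d ∧ IsJordanBound G d

/-- The Jordan constant `J_G`: the least positive `d` as above (`0` if `G` is not Jordan). -/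
def jordanConst (G : Type*) [Group G] : ℕ :=
  sInf {d : ℕ | 0 < d ∧ IsJordanBound G d}

/-! ### Varieties over an algebraically closed field, as schemes over `Spec k` -/

section Varieties

variable {k : Type u} [Field k]

/-- Algebraic varieties over `k` (not necessarily irreducible): reduced separated schemes of
finite type over `k`. -/
structure IsVariety (X : Over (Spec (CommRingCat.of k))) : Prop where
  isReduced : IsReduced X.left
  isSeparated : IsSeparated X.hom
  locallyOfFiniteType : LocallyOfFiniteType X.hom
  quasiCompact : QuasiCompact X.hom

/-- Irreducible varieties (in particular nonempty). -/
structure IsIrreducibleVariety (X : Over (Spec (CommRingCat.of k))) : Prop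
    extends IsVariety X where
  irreducibleSpace : IrreducibleSpace X.left

/-- The points of a variety: the closed points of the scheme. -/
def Pt (X : Over (Spec (CommRingCat.of k))) : Type u :=
  {x : X.left // IsClosed ({x} : Set X.left)}

/-- The action on points of an automorphism of `X` over `k`. -/
def Pt.map {X : Over (Spec (CommRingCat.of k))} (g : Aut X) (x : Pt X) : Pt X :=
  ⟨g.hom.left x.1, by
    have : IsIso g.hom.left := ((Over.forget _).mapIso g).isIso_hom
    have h := (g.hom.left.homeomorph.isClosedMap) _ x.2
    rwa [Set.image_singleton] at h⟩

/-- An equivalence relation on the points of `X` is `Aut(X)`-stable if each of its classes is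
mapped to itself by each automorphism of `X`. -/
def IsAutStable (X : Over (Spec (CommRingCat.of k))) (r : Setoid (Pt X)) : Prop :=
  ∀ (g : Aut X) (x : Pt X), r (Pt.map g x) x

/-- The local ring `𝒪_{x,X}`. -/
abbrev Pt.localRing {X : Over (Spec (CommRingCat.of k))} (x : Pt X) : CommRingCat.{u} :=
  X.left.presheaf.stalk x.1

/-- The Zariski tangent space `T_{x,X}`: the dual of `𝔪 / 𝔪²` over the residue field. -/
abbrev Pt.TangentSpace {X : Over (Spec (CommRingCat.of k))} (x : Pt X) : Type u :=
  Module.Dual (IsLocalRing.ResidueField x.localRing) (IsLocalRing.CotangentSpace x.localRing)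

/-- `dim T_{x,X}`; on a variety the residue field at `x` is `k`. -/
def Pt.tangentDim {X : Over (Spec (CommRingCat.of k))} (x : Pt X) : ℕ :=
  Module.finrank (IsLocalRing.ResidueField x.localRing) x.TangentSpace

/-- The structure map `k → 𝒪_{x,X}`. -/
def Pt.algebraMap {X : Over (Spec (CommRingCat.of k))} (x : Pt X) : k →+* x.localRing :=
  ((Scheme.ΓSpecIso (CommRingCat.of k)).inv ≫ X.hom.appTop ≫
    X.left.presheaf.germ ⊤ x.1 trivial).hom

/-- `𝒪_{x,X}` and `𝒪_{y,X}` are isomorphic as `k`-algebras. -/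
def LocalRingsIso {X : Over (Spec (CommRingCat.of k))} (x y : Pt X) : Prop :=
  ∃ e : x.localRing ≃+* y.localRing, ∀ c : k, e (x.algebraMap c) = y.algebraMap c

/-- `x` is a vertex of `X` if the dimension of the tangent space is maximal at `x`. -/
def Pt.IsVertex {X : Over (Spec (CommRingCat.of k))} (x : Pt X) : Prop :=
  ∀ y : Pt X, y.tangentDim ≤ x.tangentDim

/-- `X` is smooth at `x`, i.e. `dim T_{x,X} = dim 𝒪_{x,X}`. -/
def Pt.IsSmooth {X : Over (Spec (CommRingCat.of k))} (x : Pt X) : Prop :=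
  IsRegularLocalRing x.localRing

/-- Singular points. -/
def Pt.IsSingular {X : Over (Spec (CommRingCat.of k))} (x : Pt X) : Prop :=
  ¬ x.IsSmooth

/-- `X` is smooth if it is smooth at each of its points. -/
def IsSmoothVariety (X : Over (Spec (CommRingCat.of k))) : Prop :=
  ∀ x : Pt X, x.IsSmooth

end Varieties

/-! ### Projective space and affine cones -/

section Cones

attribute [local instance] MvPolynomial.gradedAlgebra

variable (k : Type u) [Field k] (n : ℕ)

/-- The projective space `ℙⁿ⁻¹ = Proj k[x₁, …, xₙ]` over `k`. -/
def projSpace : Over (Spec (CommRingCat.of k)) :=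
  Over.mk (Proj.toSpecZero (MvPolynomial.homogeneousSubmodule (Fin n) k) ≫
    Spec.map (CommRingCat.ofHom (algebraMap k (MvPolynomial.homogeneousSubmodule (Fin n) k 0))))

variable {k n}

/-- The image of `i : Z ⟶ ℙⁿ⁻¹`, as a set of homogeneous primes of `k[x₁, …, xₙ]`. -/
def projImage {Z : Over (Spec (CommRingCat.of k))} (i : Z ⟶ projSpace k n) :
    Set (ProjectiveSpectrum (MvPolynomial.homogeneousSubmodule (Fin n) k)) :=
  Set.range fun z : Z.left => (i.left z : Proj (MvPolynomial.homogeneousSubmodule (Fin n) k))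

/-- `Z` lies in a hyperplane of `ℙⁿ⁻¹`, the zero locus of a nonzero linear form. -/
def LiesInHyperplane {Z : Over (Spec (CommRingCat.of k))} (i : Z ⟶ projSpace k n) : Prop :=
  ∃ l : MvPolynomial (Fin n) k, l.IsHomogeneous 1 ∧ l ≠ 0 ∧
    projImage i ⊆ ProjectiveSpectrum.zeroLocus (MvPolynomial.homogeneousSubmodule (Fin n) k) {l}

/-- The affine cone of `Z ⊆ ℙⁿ⁻¹`: the closed subvariety `Spec k[x₁, …, xₙ] / I(Z)` of `𝔸ⁿ`, where
`I(Z)` is the homogeneous ideal of `Z`. -/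
def affineCone {Z : Over (Spec (CommRingCat.of k))} (i : Z ⟶ projSpace k n) :
    Over (Spec (CommRingCat.of k)) :=
  Over.mk (Spec.map (CommRingCat.ofHom (algebraMap k
    (MvPolynomial (Fin n) k ⧸
      (ProjectiveSpectrum.vanishingIdeal (projImage i)).toIdeal))))

end Cones

end

/-! ### Jordan bounds: subgroups and extensions by permutation groups -/

section JordanGroups

open scoped Nat

/-! Let `C` be a finite class of an `Aut X`-stable relation. `Aut X` permutes `C`, and the kernel of
this action, of index at most `|C|!`, fixes a point `y` of `C`. A finite group of automorphisms
fixing `y` acts faithfully on the local ring at `y`: the spectrum of that ring is dense in `X`, and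
`X` is reduced and separated. It then acts faithfully on the cotangent space: in characteristic zero
an automorphism of finite order which is trivial on `𝔪/𝔪²` is trivial modulo every power of `𝔪`,
hence trivial by Krull's intersection theorem. So the group embeds in `GL_m(k)`, with `m` the
maximal tangent dimension, and Jordan's theorem for `GL_m` gives the bound
(`IsAutStable.isJordanBound`).

Jordan's theorem (`isJordanGroup_GL`) is proved on the way. The entries of a finite matrix group
generate a finitely generated `ℚ`-algebra, which specializes to `ℂ`; averaging a Hermitian form
makes the group unitary; by Frobenius' argument the elements close to `1` commute, and a covering of
the unit ball by small balls bounds the index of the subgroup they generate.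

The criteria on isomorphic local rings, vertices and singular points follow, because tangent
dimension and smoothness are invariants of the local ring and so define stable relations.

For the affine cone, the apex is the only vertex. As `Z` lies in no hyperplane, the equations of the
cone have no linear terms, so the tangent space at the apex has dimension `n`. At any other point,
smoothness of `Z` and `Z ≠ ℙⁿ⁻¹` give an equation with nonzero differential, so the dimension is
less than `n`. Both estimates are the Jacobian criterion, stated for `MvPolynomial.IsLocalAt` so
that it applies to the cone and to a chart of `Z` alike. -/

/-- A finite group embedding in a group with Jordan bound `d` has a normal abelian subgroup of index
at most `d`. -/
theorem IsJordanBound.exists_of_injective {G K : Type*} [Group G] [Group K] [Finite K] {d : ℕ}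
    (h : IsJordanBound G d) (f : K →* G) (hf : Function.Injective f) :
    ∃ A : Subgroup K, A.Normal ∧ IsMulCommutative A ∧ A.index ≤ d := by
  have : Finite f.range := Set.finite_range f
  obtain ⟨A, hA, hcomm, hidx⟩ := h f.range inferInstance
  refine ⟨A.comap f.rangeRestrict, hA.comap _, ⟨⟨fun a b => ?_⟩⟩, ?_⟩
  · have := hcomm.is_comm.comm ⟨_, a.2⟩ ⟨_, b.2⟩
    have h2 := congrArg (fun t : A => ((t : f.range) : G)) this
    apply Subtype.ext
    apply hf
    simpa using h2
  · rwa [Subgroup.index_comap_of_surjective _ f.rangeRestrict_surjective]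

theorem IsJordanGroup.jordanConst_spec {G : Type*} [Group G] (h : IsJordanGroup G) :
    0 < jordanConst G ∧ IsJordanBound G (jordanConst G) :=
  Nat.sInf_mem (s := {d : ℕ | 0 < d ∧ IsJordanBound G d}) h

theorem jordanConst_le {G : Type*} [Group G] {d : ℕ} (hd : 0 < d) (h : IsJordanBound G d) :
    jordanConst G ≤ d :=
  Nat.sInf_le (s := {d : ℕ | 0 < d ∧ IsJordanBound G d}) ⟨hd, h⟩

/-- Intersecting the conjugates of a normal abelian subgroup of a normal subgroup. -/
theorem Subgroup.exists_normal_isMulCommutative_of_normal {K : Type*} [Group K] [Finite K]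
    (N : Subgroup K) [N.Normal] (A : Subgroup N) (hA : A.Normal) (hc : IsMulCommutative A) :
    ∃ B : Subgroup K, B.Normal ∧ IsMulCommutative B ∧ B.index ≤ N.index * A.index ^ N.index := by
  classical
  have := Fintype.ofFinite (K ⧸ N)
  -- One conjugate for each coset of `N` suffices, since `A` is already normal in `N`; this bounds
  -- the number of factors by `N.index`.
  let D : Subgroup N := ⨅ q : K ⧸ N, A.map ((MulAut.conjNormal q.out : MulAut N) : N →* N)
  have hD : D.index ≤ A.index ^ N.index := by
    refine (Subgroup.index_iInf_le _).trans (le_of_eq ?_)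
    rw [Finset.prod_congr rfl (fun q _ => ?_), Finset.prod_const, Finset.card_univ,
      Subgroup.index_eq_card N, Nat.card_eq_fintype_card]
    exact Subgroup.index_map_equiv A (MulAut.conjNormal q.out : MulAut N)
  refine ⟨(A.map N.subtype).normalCore, inferInstance, ⟨⟨fun a b => ?_⟩⟩, ?_⟩
  · obtain ⟨a', ha', hae⟩ := Subgroup.normalCore_le _ a.2
    obtain ⟨b', hb', hbe⟩ := Subgroup.normalCore_le _ b.2
    have := congrArg (fun t : A => ((t : N) : K)) (hc.is_comm.comm ⟨a', ha'⟩ ⟨b', hb'⟩)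
    apply Subtype.ext
    simpa [← hae, ← hbe] using this
  · have hle : D.map N.subtype ≤ (A.map N.subtype).normalCore := by
      rintro _ ⟨d, hd, rfl⟩ b
      have hq := Subgroup.mem_iInf.1 hd (QuotientGroup.mk b⁻¹)
      obtain ⟨n, hn⟩ := QuotientGroup.mk_out_eq_mul N b⁻¹
      obtain ⟨a, ha, hae⟩ := hq
      -- The chosen coset representative is `b⁻¹ * n` with `n` in `N`; the factor `n` is absorbed by
      -- normality of `A` in `N`.
      refine ⟨n * a * n⁻¹, hA.conj_mem a ha n, ?_⟩
      have : (d : K) = b⁻¹ * n * a * (b⁻¹ * n)⁻¹ := by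
        rw [← hae, ← hn]
        exact MulAut.conjNormal_apply _ _
      simp [this, mul_assoc]
    calc _ ≤ (D.map N.subtype).index := Nat.le_of_dvd (Nat.pos_of_ne_zero
            (Subgroup.FiniteIndex.index_ne_zero)) (Subgroup.index_dvd_of_le hle)
      _ = D.index * N.index := by
          rw [← Subgroup.relIndex_mul_index (Subgroup.map_subtype_le D), Subgroup.relIndex,
            Subgroup.subgroupOf, Subgroup.comap_map_eq_self_of_injective N.subtype_injective]
      _ ≤ _ := by rw [mul_comm]; gcongr

/-- A finite `K` meets `ker σ` in a normal subgroup of index at most `|C|!`, and intersecting the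
conjugates of a normal abelian subgroup of this intersection gives one that is normal in `K`. -/
theorem IsJordanBound.of_ker {G C : Type*} [Group G] [Finite C] {d : ℕ}
    (σ : G →* Equiv.Perm C) (h : IsJordanBound σ.ker d) :
    IsJordanBound G ((Nat.card C)! * d ^ (Nat.card C)!) := by
  intro K hK
  let τ := σ.comp K.subtype
  have hN : τ.ker.index ≤ (Nat.card C)! := by
    rw [Subgroup.index_ker, ← Nat.card_perm]
    exact Nat.card_le_card_of_injective _ Subtype.val_injective
  obtain ⟨A, hA, hc, hi⟩ := h.exists_of_injective (K := τ.ker)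
    ((K.subtype.comp τ.ker.subtype).codRestrict σ.ker fun x => x.2) (fun a b hab => by
      exact Subtype.ext (Subtype.ext (congrArg (fun t : σ.ker => (t : G)) hab)))
  obtain ⟨B, hB, hBc, hBi⟩ := Subgroup.exists_normal_isMulCommutative_of_normal τ.ker A hA hc
  refine ⟨B, hB, hBc, hBi.trans ?_⟩
  have hd : 0 < d := (Nat.pos_of_ne_zero (Subgroup.FiniteIndex.index_ne_zero)).trans_le hi
  calc _ ≤ τ.ker.index * d ^ τ.ker.index := by gcongr
    _ ≤ _ := Nat.mul_le_mul hN (Nat.pow_le_pow_right hd hN)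

end JordanGroups

/-! ### Jordan's theorem for finite unitary groups -/

section Frobenius

variable {E : Type*} [NormedAddCommGroup E] [InnerProductSpace ℂ E] [FiniteDimensional ℂ E]

/-- Frobenius: if a unitary operator `A` commutes with its conjugate by a unitary operator `B` close
to `1`, then it commutes with `B`. -/
theorem commute_of_commute_conj_of_norm_sub_one_lt {A B : unitary (E →L[ℂ] E)}
    (hB : ‖(B : E →L[ℂ] E) - 1‖ < 1) (h : Commute A (B * A * B⁻¹)) : Commute A B := by
  set A' := B * A * B⁻¹ with hA'
  by_contra hne
  -- A difference of commuting unitaries is normal, so its norm is its spectral radius. If it is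
  -- nonzero it has a nonzero eigenvalue `ν`, and `A`, commuting with `W`, has an eigenvector `v` in
  -- that eigenspace.
  let W : E →L[ℂ] E := A' - A
  have hc : Commute (A' : E →L[ℂ] E) (A : E →L[ℂ] E) :=
    congrArg (fun t : unitary (E →L[ℂ] E) => (t : E →L[ℂ] E)) h.symm.eq
  have hW : W ≠ 0 := fun h0 => hne <| by
    have : A' = A := Subtype.ext (sub_eq_zero.1 h0)
    rw [hA', mul_inv_eq_iff_eq_mul] at this
    exact this.symm
  have hcs : ∀ {S T : unitary (E →L[ℂ] E)}, Commute S T →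
      Commute (star (S : E →L[ℂ] E)) (T : E →L[ℂ] E) := fun {S T} hST => by
    have := congrArg (fun t : unitary (E →L[ℂ] E) => (t : E →L[ℂ] E)) hST.inv_left.eq
    exact this
  have hn : IsStarNormal W := ⟨by
    simp only [W, star_sub]
    exact ((hcs (Commute.refl A')).sub_right (hcs h.symm)).sub_left
      ((hcs h).sub_right (hcs (Commute.refl A)))⟩
  have : Nontrivial E := by
    by_contra hE
    rw [not_nontrivial_iff_subsingleton] at hE
    exact hW (ContinuousLinearMap.ext fun x => Subsingleton.elim _ _)
  obtain ⟨ν, hν, hνn⟩ := spectrum.exists_nnnorm_eq_spectralRadius (a := W)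
  rw [IsStarNormal.spectralRadius_eq_nnnorm] at hνn
  have hν0 : ν ≠ 0 := fun h0 => hW <| by
    rw [h0, nnnorm_zero, ENNReal.coe_inj, eq_comm] at hνn
    exact nnnorm_eq_zero.1 hνn
  have hνe : Module.End.HasEigenvalue (W : E →ₗ[ℂ] E) ν := by
    rw [Module.End.hasEigenvalue_iff_mem_spectrum,
      ← AlgEquiv.spectrum_eq (Module.End.toContinuousLinearMap E)]
    exact hν
  let F := Module.End.eigenspace (W : E →ₗ[ℂ] E) ν
  have : Nontrivial F := Submodule.nontrivial_iff_ne_bot.2 hνe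
  have hAF : ∀ x ∈ F, ((A : E →L[ℂ] E) : E →ₗ[ℂ] E) x ∈ F := fun x hx => by
    rw [Module.End.mem_eigenspace_iff] at hx ⊢
    have h1 : Commute (A : E →L[ℂ] E) W := hc.symm.sub_right (Commute.refl _)
    have h2 := congrArg (fun t : E →L[ℂ] E => t x) h1.eq
    simp only [mul_apply_eq_comp] at h2
    simp only [ContinuousLinearMap.coe_coe] at hx ⊢
    rw [← h2, hx, map_smul]
  obtain ⟨c, hc⟩ := Module.End.exists_eigenvalue (LinearMap.restrict _ hAF)
  obtain ⟨v, hv⟩ := hc.exists_hasEigenvector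
  have hv0 : (v : E) ≠ 0 := fun h0 => hv.2 (Subtype.ext h0)
  have hAv : (A : E →L[ℂ] E) v = c • (v : E) := congrArg Subtype.val hv.apply_eq_smul
  have hWv : W v = ν • (v : E) := Module.End.mem_eigenspace_iff.1 v.2
  have hA'v : (A' : E →L[ℂ] E) v = (ν + c) • (v : E) := by
    rw [add_smul, ← hWv, ← hAv]; simp [W]
  -- Conjugating back, `w = B⁻¹ v` is an eigenvector of `A` for `ν + c`, whereas `v` has eigenvalue
  -- `c`. Hence `v ⊥ w`, so `‖v - w‖² = 2‖v‖²`, too far apart for `w` to be moved to `v` by `B` with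
  -- `‖B - 1‖ < 1`.
  let w : E := (B⁻¹ : unitary (E →L[ℂ] E)).1 v
  have hAw : (A : E →L[ℂ] E) w = (ν + c) • w := by
    have h1 : A * B⁻¹ = B⁻¹ * A' := by rw [hA']; group
    have h2 := congrArg (fun t : unitary (E →L[ℂ] E) => (t : E →L[ℂ] E) v) h1
    simp only [Submonoid.coe_mul, mul_apply_eq_comp] at h2
    rw [h2, hA'v, map_smul]
  have hBw : (B : E →L[ℂ] E) w = v := by
    exact congrArg (fun t : unitary (E →L[ℂ] E) => (t : E →L[ℂ] E) v) (mul_inv_cancel B)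
  have hU : ∀ (U : unitary (E →L[ℂ] E)) (x y : E), inner ℂ (U.1 x) (U.1 y) = inner ℂ x y :=
    fun U x y => U.1.inner_map_map_of_mem_unitary U.2 x y
  have hcc : (starRingEnd ℂ) c * c = 1 := by
    have := hU A v v
    rw [hAv, inner_smul_left, inner_smul_right, ← mul_assoc] at this
    exact mul_right_cancel₀ (inner_self_ne_zero.2 hv0) (this.trans (one_mul _).symm)
  have hvw : inner ℂ (v : E) w = 0 := by
    have := hU A v w
    rw [hAv, hAw, inner_smul_left, inner_smul_right, ← mul_assoc, mul_add, hcc] at this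
    have h3 : (starRingEnd ℂ) c * ν * inner ℂ (v : E) w = 0 := by linear_combination this
    have hc0 : (starRingEnd ℂ) c ≠ 0 := left_ne_zero_of_mul_eq_one hcc
    exact (mul_eq_zero.1 h3).resolve_left (mul_ne_zero hc0 hν0)
  have hwn : ‖w‖ = ‖(v : E)‖ := by
    have := hU B⁻¹ v v
    rw [inner_self_eq_norm_sq_to_K, inner_self_eq_norm_sq_to_K] at this
    have h2 : ‖w‖ ^ 2 = ‖(v : E)‖ ^ 2 := by exact_mod_cast this
    exact (sq_eq_sq₀ (norm_nonneg _) (norm_nonneg _)).1 h2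
  have hle : ‖(v : E) - w‖ ≤ ‖(B : E →L[ℂ] E) - 1‖ * ‖(v : E)‖ := by
    rw [← hwn]
    simpa [hBw] using ((B : E →L[ℂ] E) - 1).le_opNorm w
  have hpy : ‖(v : E) - w‖ * ‖(v : E) - w‖ = ‖(v : E)‖ * ‖(v : E)‖ + ‖w‖ * ‖w‖ := by
    simpa [sub_eq_add_neg] using norm_add_sq_eq_norm_sq_add_norm_sq_of_inner_eq_zero (𝕜 := ℂ)
      (v : E) (-w) (by simpa using hvw)
  have hvp : 0 < ‖(v : E)‖ := norm_pos_iff.2 hv0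
  rw [hwn] at hpy
  have : ‖(v : E) - w‖ < ‖(v : E)‖ := hle.trans_lt (by nlinarith)
  nlinarith [norm_nonneg ((v : E) - w)]

/-- Multiplying by the unitary `B * A` keeps the norm and turns the left side into the additive
commutator of `A - 1` and `B - 1`. -/
theorem norm_unitary_commutator_sub_one_le (A B : unitary (E →L[ℂ] E)) :
    ‖((A * B * A⁻¹ * B⁻¹ : unitary (E →L[ℂ] E)) : E →L[ℂ] E) - 1‖ ≤
      2 * ‖(A : E →L[ℂ] E) - 1‖ * ‖(B : E →L[ℂ] E) - 1‖ := by
  have h : (((A * B * A⁻¹ * B⁻¹ : unitary (E →L[ℂ] E)) : E →L[ℂ] E) - 1) * ((B * A : unitary (E →L[ℂ] E)) :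
      E →L[ℂ] E) = (A - 1) * (B - 1) - (B - 1) * (A - 1) := by
    rw [sub_mul, ← Submonoid.coe_mul,
      show A * B * A⁻¹ * B⁻¹ * (B * A) = A * B by group]
    simp only [Submonoid.coe_mul]
    noncomm_ring
  rw [← CStarRing.norm_mul_coe_unitary _ (B * A), h]
  refine (norm_sub_le _ _).trans ?_
  have h1 := norm_mul_le ((A : E →L[ℂ] E) - 1) ((B : E →L[ℂ] E) - 1)
  have h2 := norm_mul_le ((B : E →L[ℂ] E) - 1) ((A : E →L[ℂ] E) - 1)
  linarith

/-- The iterated commutators `b i` of `A` with `B` tend to `1`, hence equal `1` at some stage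
because `K` is finite. Frobenius' lemma then carries commutation with `A` from `b (i + 1)` down to
`b i`. -/
theorem commute_of_norm_sub_one_lt {K : Subgroup (unitary (E →L[ℂ] E))} [Finite K]
    {A B : unitary (E →L[ℂ] E)} (hA : A ∈ K) (hB : B ∈ K)
    (hA' : ‖(A : E →L[ℂ] E) - 1‖ < 1 / 2) (hB' : ‖(B : E →L[ℂ] E) - 1‖ < 1 / 2) :
    Commute A B := by
  let b : ℕ → unitary (E →L[ℂ] E) := fun i => (fun x => A * x * A⁻¹ * x⁻¹)^[i] B
  have hb : ∀ i, b (i + 1) = A * b i * A⁻¹ * (b i)⁻¹ := fun i => Function.iterate_succ_apply' _ _ _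
  have hbK : ∀ i, b i ∈ K := by
    intro i
    induction i with
    | zero => exact hB
    | succ i ih =>
      rw [hb]
      exact K.mul_mem (K.mul_mem (K.mul_mem hA ih) (K.inv_mem hA)) (K.inv_mem ih)
  have hbn : ∀ i, ‖(b i : E →L[ℂ] E) - 1‖ ≤ (2 * ‖(A : E →L[ℂ] E) - 1‖) ^ i * (1 / 2) := by
    intro i
    induction i with
    | zero => simpa [b] using hB'.le
    | succ i ih =>
      rw [hb, pow_succ']
      refine (norm_unitary_commutator_sub_one_le _ _).trans ?_
      rw [mul_assoc (2 * _)]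
      gcongr
  have hb1 : ∀ i, ‖(b i : E →L[ℂ] E) - 1‖ < 1 := fun i => by
    have : (2 * ‖(A : E →L[ℂ] E) - 1‖) ^ i ≤ 1 := pow_le_one₀ (by positivity) (by linarith)
    linarith [hbn i]
  have hex : ∃ i, b i = 1 := by
    by_contra! hne
    have hfin : (Set.range fun g : K => ‖((g : unitary (E →L[ℂ] E)) : E →L[ℂ] E) - 1‖).Finite :=
      Set.finite_range _
    have htend : Filter.Tendsto (fun i => ‖(b i : E →L[ℂ] E) - 1‖) Filter.atTop (nhds 0) := by
      refine squeeze_zero (fun _ => norm_nonneg _) hbn ?_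
      have := (tendsto_pow_atTop_nhds_zero_of_lt_one (r := 2 * ‖(A : E →L[ℂ] E) - 1‖)
        (by positivity) (by linarith)).mul_const (1 / 2)
      rwa [zero_mul] at this
    -- The nonzero values of the distance to `1` on `K` form a finite, hence closed, set, which
    -- cannot have `0` as a limit.
    have hcl := (hfin.subset (Set.sdiff_subset (t := {0}))).isClosed
    have := hcl.mem_of_tendsto htend (Filter.Eventually.of_forall fun i =>
      ⟨⟨⟨b i, hbK i⟩, rfl⟩, fun h0 => hne i (Subtype.ext (sub_eq_zero.1 (norm_eq_zero.1 h0)))⟩)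
    exact this.2 rfl
  obtain ⟨i, hi⟩ := hex
  have hci : Commute A (b i) := hi ▸ Commute.one_right A
  clear hi
  induction i with
  | zero => exact hci
  | succ i ih =>
    refine ih (commute_of_commute_conj_of_norm_sub_one_lt (hb1 i) ?_)
    rw [hb, mul_assoc, mul_assoc] at hci
    have h1 : Commute A (A⁻¹ * (A * (b i * (A⁻¹ * (b i)⁻¹)))) :=
      (Commute.refl A).inv_right.mul_right hci
    simpa [mul_assoc] using h1.inv_right

variable (E) in
/-- Jordan's theorem for unitary groups. -/
theorem exists_isJordanBound_unitary : ∃ N, IsJordanBound (unitary (E →L[ℂ] E)) N := by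
  classical
  have htb : TotallyBounded (Metric.closedBall (0 : E →L[ℂ] E) 1) :=
    (isCompact_closedBall _ _).totallyBounded
  -- Radius `1 / 4`, so that two elements of one ball are less than `1 / 2` apart, the threshold at
  -- which commutation is known.
  obtain ⟨t, -, ht, hcov⟩ := Metric.finite_approx_of_totallyBounded htb (1 / 4) (by norm_num)
  refine ⟨t.ncard, fun K _ => ?_⟩
  let S : Set K := {g | ‖((g : unitary (E →L[ℂ] E)) : E →L[ℂ] E) - 1‖ < 1 / 2}
  have hconj : ∀ g : K, ∀ x ∈ S, g * x * g⁻¹ ∈ S := fun g x hx => by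
    have : (((g * x * g⁻¹ : K) : unitary (E →L[ℂ] E)) : E →L[ℂ] E) - 1 =
        ((g : unitary (E →L[ℂ] E)) : E →L[ℂ] E) *
          (((x : unitary (E →L[ℂ] E)) : E →L[ℂ] E) - 1) *
          ((g⁻¹ : unitary (E →L[ℂ] E)) : E →L[ℂ] E) := by
      rw [mul_sub, sub_mul, mul_one, ← Submonoid.coe_mul _ _ (g⁻¹ : unitary (E →L[ℂ] E)),
        mul_inv_cancel]
      simp
    simp only [S, Set.mem_ofPred_eq] at hx ⊢
    rwa [this, CStarRing.norm_mul_coe_unitary, CStarRing.norm_coe_unitary_mul]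
  refine ⟨Subgroup.closure S, ⟨fun x hx g => ?_⟩, Subgroup.isMulCommutative_closure
    fun x hx y hy => Subtype.ext (commute_of_norm_sub_one_lt x.2 y.2 hx hy), ?_⟩
  · induction hx using Subgroup.closure_induction with
    | mem x hx => exact Subgroup.subset_closure (hconj g x hx)
    | one => simp
    | mul x y _ _ hx hy =>
      have := mul_mem hx hy
      simpa [mul_assoc] using this
    | inv x _ hx =>
      have := inv_mem hx
      simpa [mul_assoc] using this
  · have hmem : ∀ g : K, ∃ y : t, ((g : unitary (E →L[ℂ] E)) : E →L[ℂ] E) ∈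
        Metric.ball (y : E →L[ℂ] E) (1 / 4) := fun g => by
      have : ((g : unitary (E →L[ℂ] E)) : E →L[ℂ] E) ∈ Metric.closedBall (0 : E →L[ℂ] E) 1 := by
        rw [mem_closedBall_zero_iff]
        rcases subsingleton_or_nontrivial (E →L[ℂ] E) with h | h
        · rw [Subsingleton.elim ((g : unitary (E →L[ℂ] E)) : E →L[ℂ] E) 0]; simp
        · exact (CStarRing.norm_of_mem_unitary (g : unitary (E →L[ℂ] E)).2).le
      obtain ⟨y, hy, h⟩ := Set.mem_iUnion₂.1 (hcov this)
      exact ⟨⟨y, hy⟩, h⟩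
    choose f hf using hmem
    have : Finite t := ht
    rw [Subgroup.index_eq_card, ← Nat.card_coe_set_eq]
    -- If the representatives `g`, `g'` of two cosets lie in the same ball, then `g⁻¹ * g'` is
    -- within `1 / 2` of `1`, so the cosets coincide.
    refine Nat.card_le_card_of_injective (fun q : K ⧸ Subgroup.closure S => f q.out) ?_
    intro q q' hqq
    rw [← QuotientGroup.out_eq' q, ← QuotientGroup.out_eq' q', QuotientGroup.eq]
    apply Subgroup.subset_closure
    simp only at hqq
    have h1 := hf q.out
    have h2 := hf q'.out
    rw [← hqq] at h2
    have h3 := (dist_triangle_right _ _ _).trans_lt (add_lt_add h2 h1)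
    rw [dist_eq_norm, ← CStarRing.norm_coe_unitary_mul (q.out⁻¹ : unitary (E →L[ℂ] E)), mul_sub,
      ← Submonoid.coe_mul, ← Submonoid.coe_mul, inv_mul_cancel] at h3
    have h4 : (1 : ℝ) / 4 + 1 / 4 = 1 / 2 := by norm_num
    rw [h4] at h3
    exact h3

end Frobenius

/-! ### Jordan's theorem for linear groups in characteristic zero -/

section GeneralLinear

open scoped Matrix ComplexOrder MatrixOrder

/-- A finite complex linear group is conjugate to a unitary group. -/
theorem exists_star_conj_mul_conj_eq_one {n : Type*} [Fintype n] [DecidableEq n]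
    (K : Subgroup (GL n ℂ)) [Finite K] :
    ∃ u : GL n ℂ, ∀ g ∈ K, star (u * g * u⁻¹).1 * (u * g * u⁻¹).1 = 1 := by
  have := Fintype.ofFinite K
  -- The sum of the translates of the standard Hermitian form is positive definite and
  -- `K`-invariant; conjugation by its square root takes it to the standard form.
  let H : Matrix n n ℂ := ∑ g : K, ((g : GL n ℂ).1)ᴴ * (g : GL n ℂ).1
  have hinj : ∀ g : GL n ℂ, Function.Injective g.1.mulVec := fun g =>
    Matrix.mulVec_injective_of_isUnit g.isUnit
  have hH : H.PosDef := Matrix.posDef_sum ⟨1, Finset.mem_univ _⟩ fun g _ =>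
    Matrix.PosDef.conjTranspose_mul_self _ (hinj g)
  have hHg : ∀ g : K, ((g : GL n ℂ).1)ᴴ * H * (g : GL n ℂ).1 = H := fun g => by
    simp only [H, Finset.mul_sum, Finset.sum_mul]
    refine Fintype.sum_equiv (Equiv.mulRight g) _ _ fun x => ?_
    simp [Matrix.conjTranspose_mul, mul_assoc]
  have hBB : CFC.sqrt H * CFC.sqrt H = H :=
    CFC.sqrt_mul_sqrt_self H (Matrix.nonneg_iff_posSemidef.2 hH.posSemidef)
  have hBs : star (CFC.sqrt H) = CFC.sqrt H := (CFC.sqrt_nonneg H).isSelfAdjoint.star_eq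
  have hBu : IsUnit (CFC.sqrt H * CFC.sqrt H) := by
    rw [hBB]; exact hH.isUnit
  obtain ⟨u, hu⟩ := isUnit_of_mul_isUnit_left hBu
  rw [← hu] at hBB hBs
  have hus : star u.1 * u.1 = H := by rw [hBs, hBB]
  refine ⟨u, fun g hg => ?_⟩
  have h2 : star g.1 * H * g.1 = H := hHg ⟨g, hg⟩
  have h1 : star (u * g * u⁻¹).1 * (u * g * u⁻¹).1 =
      star u⁻¹.1 * (star g.1 * (star u.1 * u.1) * g.1) * u⁻¹.1 := by
    simp only [Units.val_mul, star_mul, mul_assoc]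
  have h3 := congrArg star u.mul_inv
  rw [star_mul, hBs, star_one] at h3
  rw [h1, hus, h2, ← hBB, mul_assoc, mul_assoc, Units.mul_inv, mul_one, h3]

/-- Jordan's theorem for complex linear groups. -/
theorem exists_isJordanBound_GL_complex (m : ℕ) : ∃ N, IsJordanBound (GL (Fin m) ℂ) N := by
  obtain ⟨N, hN⟩ := exists_isJordanBound_unitary (EuclideanSpace ℂ (Fin m))
  refine ⟨N, fun K _ => ?_⟩
  obtain ⟨u, hu⟩ := exists_star_conj_mul_conj_eq_one K
  let Φ : Matrix (Fin m) (Fin m) ℂ →* (EuclideanSpace ℂ (Fin m) →L[ℂ] EuclideanSpace ℂ (Fin m)) :=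
    (Matrix.toEuclideanCLM (n := Fin m) (𝕜 := ℂ) : _ →* _)
  let f : K →* (EuclideanSpace ℂ (Fin m) →L[ℂ] EuclideanSpace ℂ (Fin m)) :=
    Φ.comp ((Units.coeHom _).comp ((MulAut.conj u).toMonoidHom.comp K.subtype))
  have hf : ∀ g, f g ∈ unitary (EuclideanSpace ℂ (Fin m) →L[ℂ] EuclideanSpace ℂ (Fin m)) := by
    intro g
    have h1 : star (f g) = Φ (star (u * g * u⁻¹).1) :=
      (map_star (Matrix.toEuclideanCLM (n := Fin m) (𝕜 := ℂ)) _).symm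
    have h2 : f g = Φ (u * g * u⁻¹).1 := rfl
    rw [Unitary.mem_iff, h1, h2, ← map_mul, ← map_mul, hu g g.2, mul_eq_one_comm.1 (hu g g.2),
      map_one]
    exact ⟨rfl, rfl⟩
  refine hN.exists_of_injective (K := K) (f.codRestrict _ hf) fun a b hab => ?_
  have h1 : f a = f b := congrArg Subtype.val hab
  have h2 := (Matrix.toEuclideanCLM (n := Fin m) (𝕜 := ℂ)).injective h1
  exact Subtype.ext ((MulAut.conj u).injective (Units.ext h2))

/-- A nonzero finitely generated algebra over `ℚ` has a complex point. -/
theorem exists_ringHom_complex (A : Type*) [CommRing A] [Nontrivial A] [Algebra ℚ A]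
    [Algebra.FiniteType ℚ A] : Nonempty (A →+* ℂ) := by
  obtain ⟨M, hM⟩ := Ideal.exists_maximal A
  let _ : Field (A ⧸ M) := Ideal.Quotient.field M
  -- Zariski's lemma: the quotient is a number field, hence embeds in `ℂ`.
  have : Module.Finite ℚ (A ⧸ M) := finite_of_finite_type_of_isJacobsonRing ℚ (A ⧸ M)
  exact ⟨(IsAlgClosed.lift (R := ℚ) (S := A ⧸ M) (M := ℂ)).toRingHom.comp (Ideal.Quotient.mk M)⟩

/-- A matrix group over a field with entries in a subring `A`, together with the inverses of the
nonzero entries of the matrices `g - 1`, maps injectively to the matrices over any nonzero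
`A`-algebra. -/
theorem exists_injective_monoidHom_matrix {k R n : Type*} [Field k] [CommRing R] [Nontrivial R]
    [Fintype n] [DecidableEq n] (K : Subgroup (GL n k)) (A : Subring k)
    (hA : ∀ g ∈ K, ∀ i j, g.1 i j ∈ A) (hA' : ∀ g ∈ K, ∀ i j, ((g.1 - 1) i j)⁻¹ ∈ A)
    (φ : A →+* R) : ∃ F : K →* Matrix n n R, Function.Injective F := by
  let f : K →* Matrix n n A :=
    { toFun := fun g => Matrix.of fun i j => ⟨(g : GL n k).1 i j, hA g g.2 i j⟩
      map_one' := by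
        ext i j
        simp [Matrix.one_apply, apply_ite]
      map_mul' := fun a b => by
        ext i j
        simp [Matrix.mul_apply] }
  refine ⟨φ.mapMatrix.toMonoidHom.comp f, (injective_iff_map_eq_one _).2 fun g hg => ?_⟩
  by_contra hne
  have h0 : (g : GL n k).1 - 1 ≠ 0 := fun h0 => hne (Subtype.ext (Units.ext (sub_eq_zero.1 h0)))
  obtain ⟨i, j, hij⟩ : ∃ i j, ((g : GL n k).1 - 1) i j ≠ 0 := by
    by_contra! h
    exact h0 (Matrix.ext h)
  -- The inverse of a nonzero entry of `g - 1` lies in `A`, so this entry is a unit of `A` and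
  -- cannot be killed by `φ`.
  let c : A := ⟨_, hA' g g.2 i j⟩
  have he : (((f g - 1) i j : A) : k) = ((g : GL n k).1 - 1) i j := by
    rw [Matrix.sub_apply, Matrix.sub_apply, AddSubgroupClass.coe_sub]
    congr 1
    by_cases h : i = j <;> simp [Matrix.one_apply, h]
  have hc : c * ((f g - 1) i j) = 1 := by
    apply Subtype.ext
    rw [Subring.coe_mul, he]
    exact inv_mul_cancel₀ hij
  have h1 : φ.mapMatrix (f g - 1) = 0 := by
    rw [map_sub, map_one, sub_eq_zero]
    exact hg
  have h2 : φ ((f g - 1) i j) = 0 := congrArg (fun M : Matrix n n R => M i j) h1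
  have := congrArg φ hc
  rw [map_mul, h2, mul_zero, map_one] at this
  exact zero_ne_one this

/-- Jordan's theorem. -/
theorem isJordanGroup_GL (k : Type*) [Field k] [CharZero k] (m : ℕ) :
    IsJordanGroup (GL (Fin m) k) := by
  obtain ⟨N, hN⟩ := exists_isJordanBound_GL_complex m
  -- The successor only ensures positivity of the bound.
  refine ⟨N + 1, N.succ_pos, fun K _ => ?_⟩
  let S : Set k := (Set.range fun p : K × Fin m × Fin m => (p.1 : GL (Fin m) k).1 p.2.1 p.2.2) ∪
    Set.range fun p : K × Fin m × Fin m => (((p.1 : GL (Fin m) k).1 - 1) p.2.1 p.2.2)⁻¹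
  have hS : S.Finite := (Set.finite_range _).union (Set.finite_range _)
  have hA : Algebra.FiniteType ℚ (Algebra.adjoin ℚ S) :=
    (Subalgebra.fg_iff_finiteType _).1 (Subalgebra.fg_def.2 ⟨S, hS, rfl⟩)
  obtain ⟨φ⟩ := exists_ringHom_complex (Algebra.adjoin ℚ S)
  obtain ⟨F, hF⟩ := exists_injective_monoidHom_matrix K (Algebra.adjoin ℚ S).toSubring
    (fun g hg i j => Algebra.subset_adjoin (Or.inl ⟨(⟨g, hg⟩, i, j), rfl⟩))
    (fun g hg i j => Algebra.subset_adjoin (Or.inr ⟨(⟨g, hg⟩, i, j), rfl⟩)) φ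
  obtain ⟨D, h1, h2, h3⟩ := hN.exists_of_injective F.toHomUnits fun a b hab =>
    hF (congrArg Units.val hab)
  exact ⟨D, h1, h2, h3.trans N.le_succ⟩

end GeneralLinear

/-! ### Finite group actions on local rings and cotangent spaces -/

section LocalAlgebra

open IsLocalRing

variable {R : Type*} [CommRing R] [IsLocalRing R]

/-- An endomorphism which is trivial modulo `I` and on `I / I²` is trivial on each `Iⁿ / Iⁿ⁺¹`. -/
theorem RingHom.sub_self_mem_pow_succ {R : Type*} [CommRing R] {I : Ideal R} (φ : R →+* R)
    (h2 : ∀ a ∈ I, φ a - a ∈ I ^ 2) (n : ℕ) {a : R} (ha : a ∈ I ^ (n + 1)) :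
    φ a - a ∈ I ^ (n + 2) := by
  have hφI : ∀ a ∈ I, φ a ∈ I := fun a ha => by
    have := I.add_mem (Ideal.pow_le_self two_ne_zero (h2 a ha)) ha
    simpa using this
  induction n generalizing a with
  | zero => exact h2 a (by simpa using ha)
  | succ n ih =>
    rw [pow_succ] at ha
    induction ha using Submodule.mul_induction_on' with
    | mem_mul_mem x hx y hy =>
      have e : φ (x * y) - x * y = (φ x - x) * φ y + x * (φ y - y) := by rw [map_mul]; ring
      rw [e]
      refine Ideal.add_mem _ ?_ ?_
      · rw [show n + 1 + 2 = n + 2 + 1 from rfl, pow_succ]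
        exact Ideal.mul_mem_mul (ih hx) (hφI y hy)
      · rw [show n + 1 + 2 = (n + 1) + 2 from rfl, pow_add]
        exact Ideal.mul_mem_mul hx (h2 y hy)
    | add x _ y _ hx hy =>
      have := Ideal.add_mem _ hx hy
      rw [map_add]
      convert this using 1
      ring

/-- An endomorphism of finite order of a Noetherian local ring of characteristic zero which is
trivial on the residue field and on the cotangent space is trivial. -/
theorem IsLocalRing.eq_id_of_iterate_eq_id [IsNoetherianRing R] [Algebra ℚ R]
    (φ : R →+* R) {N : ℕ} (hN : 0 < N) (hφ : ∀ a, φ^[N] a = a)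
    (h1 : ∀ a, φ a - a ∈ maximalIdeal R) (h2 : ∀ a ∈ maximalIdeal R, φ a - a ∈ maximalIdeal R ^ 2)
    (a : R) : φ a = a := by
  have key : ∀ n, ∀ a, φ a - a ∈ maximalIdeal R ^ (n + 1) := by
    intro n
    induction n with
    | zero => simpa using h1
    | succ n ih =>
      intro a
      -- Modulo `𝔪ⁿ⁺²`, each application of `φ` adds the same increment `φ a - a`. After `N` steps
      -- the total `N * (φ a - a)` must vanish, and `N` is invertible.
      have hs : ∀ i, φ^[i] a - a - i * (φ a - a) ∈ maximalIdeal R ^ (n + 2) := by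
        intro i
        induction i with
        | zero => simp
        | succ i hi =>
          have h3 : φ (φ^[i] a - a) - (φ^[i] a - a) ∈ maximalIdeal R ^ (n + 2) := by
            refine φ.sub_self_mem_pow_succ h2 n ?_
            have := Ideal.add_mem _ (Ideal.pow_le_pow_right (Nat.le_succ _) hi)
              (Ideal.mul_mem_left _ (i : R) (ih a))
            simpa using this
          have := Ideal.add_mem _ hi h3
          rw [Function.iterate_succ_apply']
          convert this using 1
          rw [map_sub]
          push_cast
          ring
      have h3 := hs N
      rw [hφ, sub_self, zero_sub, Ideal.neg_mem_iff] at h3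
      have hu : algebraMap ℚ R (N : ℚ)⁻¹ * N = 1 := by
        rw [← map_natCast (algebraMap ℚ R), ← map_mul,
          inv_mul_cancel₀ (Nat.cast_ne_zero.2 hN.ne'), map_one]
      have := Ideal.mul_mem_left _ (algebraMap ℚ R (N : ℚ)⁻¹) h3
      rwa [← mul_assoc, hu, one_mul] at this
  have h0 : φ a - a ∈ ⨅ n, maximalIdeal R ^ n := by
    rw [Ideal.mem_iInf]
    exact fun n => Ideal.pow_le_pow_right (Nat.le_succ n) (key n a)
  rw [Ideal.iInf_pow_eq_bot_of_isLocalRing _ (maximalIdeal.isMaximal R).ne_top] at h0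
  exact sub_eq_zero.1 h0

variable {k : Type*} [Field k] [Algebra k R]

/-- A finite group acting faithfully on a Noetherian local `k`-algebra with residue field `k` acts
faithfully on the cotangent space. -/
theorem IsLocalRing.exists_injective_monoidHom_cotangentSpace [IsNoetherianRing R] [CharZero k]
    (hk : Function.Surjective (algebraMap k (ResidueField R)))
    {G : Type*} [Group G] [Finite G] (ρ : G →* (R →ₐ[k] R)) (hρ : Function.Injective ρ) :
    ∃ f : G →* Module.End k (CotangentSpace R), Function.Injective f := by
  have hloc : ∀ g, maximalIdeal R ≤ (maximalIdeal R).comap (ρ g) := fun g a ha => by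
    rw [Ideal.mem_comap, mem_maximalIdeal, mem_nonunits_iff] at *
    intro hu
    apply ha
    have := hu.map (ρ g⁻¹)
    rwa [← AlgHom.mul_apply, ← map_mul, inv_mul_cancel, map_one, AlgHom.one_apply] at this
  let f : G →* Module.End k (CotangentSpace R) :=
    { toFun := fun g => Ideal.mapCotangent _ _ (ρ g) (hloc g)
      map_one' := by
        ext x
        obtain ⟨x, rfl⟩ := Ideal.toCotangent_surjective _ x
        simp
      map_mul' := fun g h => by
        ext x
        obtain ⟨x, rfl⟩ := Ideal.toCotangent_surjective _ x
        simp }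
  refine ⟨f, (injective_iff_map_eq_one _).2 fun g hg => hρ ?_⟩
  rw [map_one]
  ext a
  have : Algebra ℚ R := ((algebraMap k R).comp (algebraMap ℚ k)).toAlgebra
  refine IsLocalRing.eq_id_of_iterate_eq_id (ρ g : R →+* R) (orderOf_pos g) (fun a => ?_)
    (fun a => ?_) (fun a ha => ?_) a
  · have h := congrArg (fun t : R →ₐ[k] R => t a) (map_pow ρ g (orderOf g))
    rw [pow_orderOf_eq_one, map_one] at h
    simpa [AlgHom.coe_pow] using h.symm
  · obtain ⟨c, hc⟩ := hk (residue R a)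
    have hc' : a - algebraMap k R c ∈ maximalIdeal R := by
      rw [← residue_eq_zero_iff, map_sub, ← hc, sub_eq_zero]
      rfl
    have := (maximalIdeal R).sub_mem (hloc g hc') hc'
    simpa using this
  · have := congrArg (fun t : Module.End k (CotangentSpace R) =>
      t ((maximalIdeal R).toCotangent ⟨a, ha⟩)) hg
    simpa [f, Ideal.toCotangent_eq] using this

theorem IsLocalRing.finrank_cotangentSpace_eq [IsNoetherianRing R]
    (hk : Function.Surjective (algebraMap k (ResidueField R))) :
    FiniteDimensional k (CotangentSpace R) ∧
    Module.finrank k (CotangentSpace R) = Module.finrank (ResidueField R) (CotangentSpace R) := by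
  have : IsScalarTower k (ResidueField R) (CotangentSpace R) := by
    refine ⟨fun c x y => ?_⟩
    obtain ⟨x, rfl⟩ := residue_surjective x
    obtain ⟨y, rfl⟩ := Ideal.toCotangent_surjective _ y
    have h : ∀ (r : R) (z : maximalIdeal R), residue R r • (maximalIdeal R).toCotangent z =
        r • (maximalIdeal R).toCotangent z := fun r z =>
      algebraMap_smul (ResidueField R) r ((maximalIdeal R).toCotangent z)
    have h' : c • residue R x = residue R (c • x) := by
      rw [Algebra.smul_def, Algebra.smul_def, map_mul]
      rfl
    rw [h', h, h, smul_assoc]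
  have e : k ≃ₗ[k] ResidueField R := LinearEquiv.ofBijective
    (Algebra.linearMap k (ResidueField R)) ⟨(algebraMap k _).injective, hk⟩
  have h1 : Module.finrank k (ResidueField R) = 1 := by
    rw [← e.finrank_eq, Module.finrank_self]
  have : FiniteDimensional k (ResidueField R) := e.finiteDimensional
  refine ⟨Module.Finite.trans (ResidueField R) _, ?_⟩
  rw [← Module.finrank_mul_finrank k (ResidueField R), h1, one_mul]

/-- A trivial summand pads the representation to dimension exactly `m`, so that one `m` serves for
all points. -/
theorem exists_injective_monoidHom_GL {k : Type*} [Field k] {G V : Type*} [Group G] [AddCommGroup V]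
    [Module k V] [FiniteDimensional k V] (f : G →* Module.End k V) (hf : Function.Injective f)
    {m : ℕ} (hm : Module.finrank k V ≤ m) : ∃ F : G →* GL (Fin m) k, Function.Injective F := by
  let W := V × (Fin (m - Module.finrank k V) → k)
  have hW : Module.finrank k W = m := by
    rw [Module.finrank_prod, Module.finrank_fin_fun, Nat.add_sub_cancel' hm]
  let b := Module.finBasisOfFinrankEq k W hW
  let f' : G →* Module.End k W :=
    { toFun := fun g => LinearMap.prodMap (f g) LinearMap.id
      map_one' := by ext <;> simp
      map_mul' := fun g h => by ext <;> simp }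
  refine ⟨(((LinearMap.toMatrixAlgEquiv b : Module.End k W →* Matrix (Fin m) (Fin m) k)).comp
    f').toHomUnits, fun g h hgh => hf ?_⟩
  have h1 := (LinearMap.toMatrixAlgEquiv b).injective (congrArg Units.val hgh)
  ext v
  exact congrArg Prod.fst (congrArg (fun t : Module.End k W => t (v, 0)) h1)

end LocalAlgebra

/-! ### Automorphisms fixing a point, and invariants of local rings -/

section Points

open IsLocalRing

variable {k : Type u} [Field k] {X : Over (Spec (CommRingCat.of k))}

/-- This allows `k`-linearity of maps between local rings to be checked on morphisms of schemes over
`Spec k`. -/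
theorem Pt.SpecMap_algebraMap (x : Pt X) :
    Spec.map (CommRingCat.ofHom x.algebraMap) = X.left.fromSpecStalk x.1 ≫ X.hom := by
  have h1 : X.hom ≫ (Spec (CommRingCat.of k)).toSpecΓ =
    X.left.toSpecΓ ≫ Spec.map X.hom.appTop := Scheme.toSpecΓ_naturality X.hom
  have h2 := X.left.fromSpecStalk_toSpecΓ x.1
  have h3 : (Spec (CommRingCat.of k)).toSpecΓ ≫
      Spec.map (Scheme.ΓSpecIso (CommRingCat.of k)).inv = 𝟙 _ :=
    toSpecΓ_SpecMap_ΓSpecIso_inv _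
  rw [← Category.comp_id X.hom, ← h3, reassoc_of% h1, reassoc_of% h2, ← Spec.map_comp,
    ← Spec.map_comp]
  rfl

/-- The Nullstellensatz: closed points of a scheme locally of finite type over an algebraically
closed field are rational. -/
theorem Pt.residue_comp_algebraMap_surjective [IsAlgClosed k] [LocallyOfFiniteType X.hom]
    (x : Pt X) : Function.Surjective ((residue x.localRing).comp x.algebraMap) := by
  have h : (residueFieldIsoBase X.hom x.1 x.2).inv =
      CommRingCat.ofHom ((residue x.localRing).comp x.algebraMap) := by
    apply Spec.map_injective
    rw [SpecMap_residueFieldIsoBase_inv, Scheme.fromSpecResidueField, Category.assoc,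
      ← x.SpecMap_algebraMap, ← Spec.map_comp]
    rfl
  have h2 := (ConcreteCategory.isIso_iff_bijective _).1
    (inferInstance : IsIso (residueFieldIsoBase X.hom x.1 x.2).inv)
  rw [h] at h2
  exact h2.2

theorem isNoetherianRing_localRing [LocallyOfFiniteType X.hom] (x : Pt X) :
    IsNoetherianRing x.localRing := by
  have : IsLocallyNoetherian X.left := LocallyOfFiniteType.isLocallyNoetherian X.hom
  infer_instance

theorem Pt.tangentDim_eq_spanFinrank [LocallyOfFiniteType X.hom] (x : Pt X) :
    x.tangentDim = (maximalIdeal x.localRing).spanFinrank := by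
  have := isNoetherianRing_localRing x
  rw [Pt.tangentDim, Subspace.dual_finrank_eq, spanFinrank_maximalIdeal_eq_finrank_cotangentSpace]

/-- The local endomorphism of `𝒪_{x,X}` given by an endomorphism fixing `x`. -/
theorem Pt.exists_SpecMap_comp_fromSpecStalk (x : Pt X) (g : X ⟶ X) (hg : g.left x.1 = x.1) :
    ∃ φ : x.localRing →+* x.localRing, Spec.map (CommRingCat.ofHom φ) ≫ X.left.fromSpecStalk x.1 =
      X.left.fromSpecStalk x.1 ≫ g.left := by
  refine ⟨(X.left.presheaf.stalkSpecializes (specializes_of_eq hg) ≫ g.left.stalkMap x.1).hom, ?_⟩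
  rw [CommRingCat.ofHom_hom, Spec.map_comp, Category.assoc,
    Scheme.SpecMap_stalkSpecializes_fromSpecStalk, Scheme.SpecMap_stalkMap_fromSpecStalk]

theorem Pt.eq_of_SpecMap_comp_fromSpecStalk_eq (x : Pt X) {φ ψ : x.localRing →+* x.localRing}
    (h : Spec.map (CommRingCat.ofHom φ) ≫ X.left.fromSpecStalk x.1 =
      Spec.map (CommRingCat.ofHom ψ) ≫ X.left.fromSpecStalk x.1) : φ = ψ := by
  rw [cancel_mono] at h
  exact congrArg CommRingCat.Hom.hom (Spec.map_injective h)

/-- An endomorphism of an irreducible variety inducing the identity on a local ring is trivial. -/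
theorem IsIrreducibleVariety.eq_id_of_fromSpecStalk_comp (hX : IsIrreducibleVariety X) (x : Pt X)
    (g : X ⟶ X) (hg : X.left.fromSpecStalk x.1 ≫ g.left = X.left.fromSpecStalk x.1) :
    g = 𝟙 X := by
  have := hX.isReduced
  have := hX.isSeparated
  have := hX.irreducibleSpace
  -- The image of the spectrum of the local ring consists of the generizations of `x`, among them
  -- the generic point.
  have hd : IsDominant (X.left.fromSpecStalk x.1) := by
    refine ⟨?_⟩
    rw [DenseRange, Scheme.range_fromSpecStalk]
    have h1 : genericPoint X.left ∈ {y : X.left | y ⤳ x.1} := genericPoint_specializes _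
    refine dense_iff_closure_eq.2 (Set.eq_univ_of_univ_subset ?_)
    rw [← genericPoint_closure]
    exact closure_mono (Set.singleton_subset_iff.2 h1)
  apply Over.OverMorphism.ext
  exact ext_of_isDominant_of_isSeparated X.hom (by simp) (X.left.fromSpecStalk x.1) (by simp [hg])

/-- A finite group of automorphisms fixing a point embeds in the general linear group of the
tangent space. -/
theorem IsIrreducibleVariety.exists_injective_monoidHom_GL [IsAlgClosed k] [CharZero k]
    (hX : IsIrreducibleVariety X) (x : Pt X) {N : Type*} [Group N] [Finite N] (γ : N →* Aut X)
    (hγ : Function.Injective γ) (hx : ∀ g, Pt.map (γ g) x = x) {m : ℕ} (hm : x.tangentDim ≤ m) :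
    ∃ F : N →* GL (Fin m) k, Function.Injective F := by
  have := hX.locallyOfFiniteType
  have := isNoetherianRing_localRing x
  let _ : Algebra k x.localRing := x.algebraMap.toAlgebra
  -- Pullback of functions is contravariant; taking `g⁻¹` makes `g ↦ φ g` multiplicative.
  choose φ hφ using fun g : N => x.exists_SpecMap_comp_fromSpecStalk (γ g⁻¹).hom
    (congrArg Subtype.val (hx g⁻¹))
  have hk : ∀ g c, φ g (x.algebraMap c) = x.algebraMap c := fun g c => by
    have : (φ g).comp x.algebraMap = x.algebraMap := by
      refine congrArg CommRingCat.Hom.hom (Spec.map_injective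
        (a₁ := CommRingCat.ofHom ((φ g).comp x.algebraMap)) (a₂ := CommRingCat.ofHom x.algebraMap) ?_)
      rw [CommRingCat.ofHom_comp, Spec.map_comp, x.SpecMap_algebraMap, reassoc_of% (hφ g), Over.w]
    exact congrArg (fun t : k →+* x.localRing => t c) this
  let ρ : N →* (x.localRing →ₐ[k] x.localRing) :=
    { toFun := fun g => { φ g with commutes' := hk g }
      map_one' := by
        apply AlgHom.coe_ringHom_injective
        apply x.eq_of_SpecMap_comp_fromSpecStalk_eq
        refine (hφ 1).trans ?_
        rw [inv_one, map_one]
        exact (Category.comp_id _).trans (by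
          rw [show ((1 : x.localRing →ₐ[k] x.localRing) : x.localRing →+* x.localRing) =
            RingHom.id _ from rfl, CommRingCat.ofHom_id, Spec.map_id, Category.id_comp])
      map_mul' := fun g h => by
        apply AlgHom.coe_ringHom_injective
        apply x.eq_of_SpecMap_comp_fromSpecStalk_eq
        refine (hφ (g * h)).trans ?_
        have e : Spec.map (CommRingCat.ofHom ((φ g).comp (φ h))) ≫ X.left.fromSpecStalk x.1 =
            X.left.fromSpecStalk x.1 ≫ (γ (g * h)⁻¹).hom.left := by
          rw [CommRingCat.ofHom_comp, Spec.map_comp, Category.assoc, hφ h, reassoc_of% (hφ g),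
            mul_inv_rev, map_mul, Aut.Aut_mul_def]
          rfl
        exact e.symm }
  have hρ : Function.Injective ρ := (injective_iff_map_eq_one _).2 fun g hg => by
    have h1 : φ g = RingHom.id _ := congrArg (fun t : x.localRing →ₐ[k] x.localRing =>
      (t : x.localRing →+* x.localRing)) hg
    have h2 := hφ g
    rw [h1, CommRingCat.ofHom_id, Spec.map_id, Category.id_comp] at h2
    have h3 := hX.eq_id_of_fromSpecStalk_comp x _ h2.symm
    have h4 : γ g⁻¹ = 1 := Iso.ext h3
    rw [← inv_inv g, (injective_iff_map_eq_one γ).1 hγ _ h4, inv_one]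
  have hsurj : Function.Surjective (algebraMap k (ResidueField x.localRing)) :=
    x.residue_comp_algebraMap_surjective
  obtain ⟨f, hf⟩ := IsLocalRing.exists_injective_monoidHom_cotangentSpace hsurj ρ hρ
  obtain ⟨_, hfr⟩ := IsLocalRing.finrank_cotangentSpace_eq hsurj
  refine _root_.exists_injective_monoidHom_GL f hf (hfr.trans_le ?_)
  rwa [← Subspace.dual_finrank_eq]

/-- The kernel of the permutation action on the class of `y` fixes `y`, so its finite subgroups
embed in `GL (Fin m) k`. -/
theorem IsAutStable.isJordanBound [IsAlgClosed k] [CharZero k] (hX : IsIrreducibleVariety X)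
    {r : Setoid (Pt X)} (hr : IsAutStable X r) {C : Set (Pt X)} (hC : C ∈ r.classes)
    (hfin : C.Finite) {m d : ℕ} (hm : ∀ x : Pt X, x.tangentDim ≤ m)
    (hd : IsJordanBound (GL (Fin m) k) d) :
    IsJordanBound (Aut X) (C.ncard.factorial * d ^ C.ncard.factorial) := by
  have : Finite C := hfin
  obtain ⟨y, rfl⟩ := hC
  let f : Aut X →* Function.End {x | r x y} :=
    { toFun := fun g c => ⟨Pt.map g c, r.trans (hr g c) c.2⟩
      map_one' := rfl
      map_mul' := fun _ _ => rfl }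
  have hker : IsJordanBound f.toHomPerm.ker d := fun K _ => by
    obtain ⟨F, hF⟩ := hX.exists_injective_monoidHom_GL y
      ((Subgroup.subtype _).comp K.subtype) (fun a b hab => Subtype.ext (Subtype.ext hab))
      (fun g => congrArg (fun t : Equiv.Perm {x | r x y} => ((t ⟨y, r.refl y⟩ : {x | r x y}) : Pt X))
        g.1.2) (hm y)
    exact hd.exists_of_injective F hF
  exact IsJordanBound.of_ker _ hker

theorem LocalRingsIso.map (g : Aut X) (x : Pt X) : LocalRingsIso (Pt.map g x) x := by
  have : IsIso g.hom.left := ((Over.forget _).mapIso g).isIso_hom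
  refine ⟨(asIso (g.hom.left.stalkMap x.1)).commRingCatIsoToRingEquiv, fun c => ?_⟩
  have h : CommRingCat.ofHom (Pt.map g x).algebraMap ≫ g.hom.left.stalkMap x.1 =
      CommRingCat.ofHom x.algebraMap := by
    apply Spec.map_injective
    have h1 := Scheme.SpecMap_stalkMap_fromSpecStalk_assoc g.hom.left (x := x.1) X.hom
    rw [Over.w] at h1
    exact (Spec.map_comp _ _).trans ((congrArg (Spec.map (g.hom.left.stalkMap x.1) ≫ ·)
      (Pt.map g x).SpecMap_algebraMap).trans (h1.trans x.SpecMap_algebraMap.symm))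
  exact congrArg (fun t : CommRingCat.of k ⟶ x.localRing => t.hom c) h

variable (X) in
/-- Isomorphism of local rings, as an equivalence relation on the points. -/
def localRingsSetoid : Setoid (Pt X) where
  r := LocalRingsIso
  iseqv :=
    { refl := fun _ => ⟨RingEquiv.refl _, fun _ => rfl⟩
      symm := fun ⟨e, he⟩ => ⟨e.symm, fun c => by rw [← he, e.symm_apply_apply]⟩
      trans := fun ⟨e, he⟩ ⟨f, hf⟩ => ⟨e.trans f, fun c => by
        rw [RingEquiv.trans_apply, he, hf]⟩ }

theorem LocalRingsIso.tangentDim_eq [LocallyOfFiniteType X.hom] {x y : Pt X}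
    (h : LocalRingsIso x y) : x.tangentDim = y.tangentDim := by
  obtain ⟨e, -⟩ := h
  rw [Pt.tangentDim_eq_spanFinrank, Pt.tangentDim_eq_spanFinrank, ← map_ringEquiv_maximalIdeal e,
    Ideal.spanFinrank_map_eq_of_ringEquiv]

theorem LocalRingsIso.isSmooth_iff {x y : Pt X} (h : LocalRingsIso x y) :
    x.IsSmooth ↔ y.IsSmooth := by
  obtain ⟨e, -⟩ := h
  refine ⟨fun h => ?_, fun h => ?_⟩ <;> unfold Pt.IsSmooth at *
  · exact IsRegularLocalRing.of_ringEquiv e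
  · exact IsRegularLocalRing.of_ringEquiv e.symm

end Points

/-! ### Boundedness of tangent dimensions -/

section Bounded

open IsLocalRing

/-- The maximal ideal at a rational point is generated by the translates of algebra generators. -/
theorem IsLocalRing.maximalIdeal_eq_span_of_adjoin_eq_top {k B O : Type*} [Field k] [CommRing B]
    [CommRing O] [IsLocalRing O] [Algebra k B] [Algebra B O] [Algebra k O] [IsScalarTower k B O]
    (p : Ideal B) [p.IsPrime] [IsLocalization.AtPrime O p] (s : Set B)
    (hs : Algebra.adjoin k s = ⊤) (c : B → k)
    (hc : ∀ a ∈ s, algebraMap B O a - algebraMap k O (c a) ∈ maximalIdeal O) :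
    maximalIdeal O = Ideal.span ((fun a => algebraMap B O a - algebraMap k O (c a)) '' s) := by
  set J := Ideal.span ((fun a => algebraMap B O a - algebraMap k O (c a)) '' s) with hJ
  have hle : J ≤ maximalIdeal O := Ideal.span_le.2 (by rintro _ ⟨a, ha, rfl⟩; exact hc a ha)
  refine le_antisymm (fun x hx => ?_) hle
  -- The elements congruent to a constant modulo `J` form a subalgebra containing the generators.
  -- The constant of an element of `𝔪` is `0`, as nonzero constants are units.
  have key : ∀ b : B, ∃ d : k, algebraMap B O b - algebraMap k O d ∈ J := by
    intro b
    have hb : b ∈ Algebra.adjoin k s := hs ▸ Algebra.mem_top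
    induction hb using Algebra.adjoin_induction with
    | mem b hb => exact ⟨c b, Ideal.subset_span ⟨b, hb, rfl⟩⟩
    | algebraMap r => exact ⟨r, by rw [← IsScalarTower.algebraMap_apply, sub_self]; exact J.zero_mem⟩
    | add a b _ _ ha hb =>
      obtain ⟨d, hd⟩ := ha
      obtain ⟨e, he⟩ := hb
      refine ⟨d + e, ?_⟩
      convert J.add_mem hd he using 1
      rw [map_add, map_add]; ring
    | mul a b _ _ ha hb =>
      obtain ⟨d, hd⟩ := ha
      obtain ⟨e, he⟩ := hb
      refine ⟨d * e, ?_⟩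
      convert J.add_mem (J.mul_mem_left (algebraMap B O b) hd)
        (J.mul_mem_left (algebraMap k O d) he) using 1
      rw [map_mul, map_mul]; ring
  obtain ⟨b, t, rfl⟩ := IsLocalization.exists_mk'_eq p.primeCompl x
  have hxt := IsLocalization.mk'_spec O b t
  obtain ⟨d, hd⟩ := key b
  have hb : algebraMap B O b ∈ maximalIdeal O := hxt ▸ Ideal.mul_mem_right _ _ hx
  have hdm : algebraMap k O d ∈ maximalIdeal O := by
    have := (maximalIdeal O).sub_mem hb (hle hd)
    simpa using this
  have hd0 : d = 0 := by
    by_contra hne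
    exact (mem_nonunits_iff.1 ((mem_maximalIdeal _).1 hdm))
      ((isUnit_iff_ne_zero.2 hne).map (algebraMap k O))
  rw [hd0, map_zero, sub_zero, ← hxt] at hd
  exact (Ideal.mul_unit_mem_iff_mem _ (IsLocalization.map_units O t)).1 hd

variable {k : Type u} [Field k] [IsAlgClosed k] {X : Over (Spec (CommRingCat.of k))}

theorem Pt.exists_sub_algebraMap_mem_maximalIdeal [LocallyOfFiniteType X.hom] (x : Pt X)
    (a : x.localRing) : ∃ c : k, a - x.algebraMap c ∈ maximalIdeal x.localRing := by
  obtain ⟨c, hc⟩ := x.residue_comp_algebraMap_surjective (residue _ a)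
  refine ⟨c, ?_⟩
  rw [← residue_eq_zero_iff, map_sub, sub_eq_zero, ← hc]
  rfl

/-- On an affine open set, the tangent dimension is at most the number of algebra generators. -/
theorem exists_tangentDim_le_of_isAffineOpen [LocallyOfFiniteType X.hom] {U : X.left.Opens}
    (hU : IsAffineOpen U) : ∃ n, ∀ x : Pt X, x.1 ∈ U → x.tangentDim ≤ n := by
  let φ : k →+* Γ(X.left, U) := ((Scheme.ΓSpecIso (CommRingCat.of k)).inv ≫
    X.hom.appLE ⊤ U le_top).hom
  have hφ : φ.FiniteType := by
    have h1 := X.hom.finiteType_appLE (isAffineOpen_top _) hU le_top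
    exact RingHom.FiniteType.comp h1 (RingHom.FiniteType.of_surjective _
      (ConcreteCategory.bijective_of_isIso (Scheme.ΓSpecIso (CommRingCat.of k)).inv).2)
  let _ : Algebra k Γ(X.left, U) := φ.toAlgebra
  obtain ⟨s, hs⟩ := hφ.out
  refine ⟨s.card, fun x hx => ?_⟩
  let _ : Algebra k x.localRing := x.algebraMap.toAlgebra
  let _ : Algebra Γ(X.left, U) x.localRing :=
    TopCat.Presheaf.algebra_section_stalk X.left.presheaf ⟨x.1, hx⟩
  have hst : IsScalarTower k Γ(X.left, U) x.localRing := by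
    refine IsScalarTower.of_algebraMap_eq' (congrArg CommRingCat.Hom.hom
      (?_ : (Scheme.ΓSpecIso (CommRingCat.of k)).inv ≫ X.hom.appTop ≫
        X.left.presheaf.germ ⊤ x.1 trivial = ((Scheme.ΓSpecIso (CommRingCat.of k)).inv ≫
        X.hom.appLE ⊤ U le_top) ≫ X.left.presheaf.germ U x.1 hx))
    have h1 : X.hom.appLE ⊤ U le_top ≫ X.left.presheaf.germ U x.1 hx =
        X.hom.appTop ≫ X.left.presheaf.germ ⊤ x.1 trivial :=
      (Category.assoc _ _ _).trans (congrArg (X.hom.appTop ≫ ·) (X.left.presheaf.germ_res _ _ _))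
    rw [Category.assoc, h1]
  have : IsLocalization.AtPrime x.localRing (hU.primeIdealOf ⟨x.1, hx⟩).asIdeal :=
    hU.isLocalization_stalk ⟨x.1, hx⟩
  choose c hc using fun a => x.exists_sub_algebraMap_mem_maximalIdeal
    (algebraMap Γ(X.left, U) x.localRing a)
  have h := IsLocalRing.maximalIdeal_eq_span_of_adjoin_eq_top (O := x.localRing)
    (hU.primeIdealOf ⟨x.1, hx⟩).asIdeal s hs c (fun a _ => hc a)
  rw [Pt.tangentDim_eq_spanFinrank, h]
  refine (Submodule.spanFinrank_span_le_ncard_of_finite (s.finite_toSet.image _)).trans ?_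
  exact (Set.ncard_image_le s.finite_toSet).trans (Set.ncard_coe_finset s).le

theorem IsVariety.exists_tangentDim_le (hX : IsVariety X) :
    ∃ n, ∀ x : Pt X, x.tangentDim ≤ n := by
  have := hX.locallyOfFiniteType
  have := hX.quasiCompact
  have : CompactSpace X.left := QuasiCompact.compactSpace_of_compactSpace X.hom
  obtain ⟨n, hn⟩ := (isCompact_univ (X := X.left)).induction_on
    (p := fun S => ∃ n, ∀ x : Pt X, x.1 ∈ S → x.tangentDim ≤ n) ⟨0, by simp⟩
    (fun S T hST ⟨n, hn⟩ => ⟨n, fun x hx => hn x (hST hx)⟩)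
    (fun S T ⟨n, hn⟩ ⟨m, hm⟩ => ⟨max n m, fun x hx => hx.elim
      (fun h => (hn x h).trans (le_max_left _ _)) (fun h => (hm x h).trans (le_max_right _ _))⟩)
    (fun x _ => by
      obtain ⟨_, ⟨U, hU, rfl⟩, hxU, -⟩ := X.left.isBasis_affineOpens.exists_subset_of_mem_open
        (Set.mem_univ x) isOpen_univ
      exact ⟨U, mem_nhdsWithin_of_mem_nhds (U.isOpen.mem_nhds hxU),
        exists_tangentDim_le_of_isAffineOpen hU⟩)
  exact ⟨n, fun x => hn x trivial⟩

theorem IsIrreducibleVariety.exists_isGreatest_tangentDim (hX : IsIrreducibleVariety X) :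
    ∃ m, IsGreatest (Set.range fun x : Pt X => x.tangentDim) m := by
  have := hX.locallyOfFiniteType
  have := hX.irreducibleSpace
  obtain ⟨n, hn⟩ := hX.exists_tangentDim_le
  have hne : (Set.range fun x : Pt X => x.tangentDim).Nonempty := by
    -- `X` is a Jacobson space, hence has closed points and the maximum is over a nonempty set.
    have := LocallyOfFiniteType.jacobsonSpace X.hom
    obtain ⟨x, -, hx⟩ := nonempty_inter_closedPoints (X := X.left) Set.univ_nonempty
      isClosed_univ.isLocallyClosed
    exact ⟨_, ⟨x, hx⟩, rfl⟩
  have hb : BddAbove (Set.range fun x : Pt X => x.tangentDim) := ⟨n, by rintro _ ⟨x, rfl⟩; exact hn x⟩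
  exact ⟨_, Nat.sSup_mem hne hb, fun _ h => le_csSup hb h⟩

end Bounded

/-! ### The Jordan property from finite stable classes -/

section JordanAut

variable {k : Type u} [Field k] [IsAlgClosed k] [CharZero k] {X : Over (Spec (CommRingCat.of k))}

theorem isJordanGroup_aut_of_finite_class (hX : IsIrreducibleVariety X)
    {r : Setoid (Pt X)} (hr : IsAutStable X r) {C : Set (Pt X)} (hC : C ∈ r.classes)
    (hfin : C.Finite) : IsJordanGroup (Aut X) ∧
      ∃ m : ℕ, IsGreatest (Set.range fun x : Pt X => x.tangentDim) m ∧
        jordanConst (Aut X) ≤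
          C.ncard.factorial * jordanConst (GL (Fin m) k) ^ C.ncard.factorial := by
  obtain ⟨m, hm⟩ := hX.exists_isGreatest_tangentDim
  obtain ⟨hpos, hd⟩ := (isJordanGroup_GL k m).jordanConst_spec
  have hb := hr.isJordanBound hX hC hfin (fun x => hm.2 ⟨x, rfl⟩) hd
  have h0 : 0 < C.ncard.factorial * jordanConst (GL (Fin m) k) ^ C.ncard.factorial := by positivity
  exact ⟨⟨_, h0, hb⟩, m, hm, jordanConst_le h0 hb⟩

theorem isJordanGroup_aut_of_finite_localRingsIso (hX : IsIrreducibleVariety X) (x : Pt X)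
    (hx : {y : Pt X | LocalRingsIso x y}.Finite) : IsJordanGroup (Aut X) := by
  refine (isJordanGroup_aut_of_finite_class hX (r := localRingsSetoid X)
    (fun g x => LocalRingsIso.map g x) ⟨x, rfl⟩ (hx.subset fun y hy => ?_)).1
  exact (localRingsSetoid X).symm hy

/-- A finite nonempty fibre of an invariant of local rings. -/
theorem isJordanGroup_aut_of_finite_fiber (hX : IsIrreducibleVariety X) {α : Type*} (p : Pt X → α)
    (hp : ∀ x y, LocalRingsIso x y → p x = p y) (x : Pt X) (hx : {y : Pt X | p y = p x}.Finite) :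
    IsJordanGroup (Aut X) :=
  (isJordanGroup_aut_of_finite_class hX (r := Setoid.ker p)
    (fun g x => hp _ _ (LocalRingsIso.map g x)) ⟨x, rfl⟩ hx).1

/-- The vertices are the fibre of the tangent dimension over its maximal value, which is attained.
-/
theorem isJordanGroup_aut_of_finite_isVertex (hX : IsIrreducibleVariety X)
    (h : {x : Pt X | x.IsVertex}.Finite) : IsJordanGroup (Aut X) := by
  have := hX.locallyOfFiniteType
  obtain ⟨_, ⟨x, rfl⟩, hm⟩ := hX.exists_isGreatest_tangentDim
  refine isJordanGroup_aut_of_finite_fiber hX Pt.tangentDim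
    (fun _ _ => LocalRingsIso.tangentDim_eq) x (h.subset fun y hy z => ?_)
  rw [Set.mem_ofPred_eq] at hy
  exact hy ▸ hm ⟨z, rfl⟩

theorem isJordanGroup_aut_of_finite_isSingular (hX : IsIrreducibleVariety X)
    (hns : ¬ IsSmoothVariety X) (h : {x : Pt X | x.IsSingular}.Finite) : IsJordanGroup (Aut X) := by
  obtain ⟨x, hx⟩ := not_forall.1 hns
  refine isJordanGroup_aut_of_finite_fiber hX Pt.IsSmooth
    (fun _ _ h => propext h.isSmooth_iff) x (h.subset fun y (hy : y.IsSmooth = x.IsSmooth) => ?_)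
  rw [Set.mem_ofPred_eq, Pt.IsSingular, hy]
  exact hx

end JordanAut

/-! ### The Jacobian criterion for localized quotients of polynomial rings -/

section Jacobian

open IsLocalRing MvPolynomial

variable {k σ : Type*} [Field k]

/-- The ideal of the point `y` of affine space. -/
noncomputable def MvPolynomial.pointIdeal (y : σ → k) : Ideal (MvPolynomial σ k) :=
  Ideal.span (Set.range fun j => X j - C (y j))

theorem MvPolynomial.sub_C_eval_mem_pointIdeal (y : σ → k) (f : MvPolynomial σ k) :
    f - C (eval y f) ∈ pointIdeal y := by
  induction f using MvPolynomial.induction_on with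
  | C a => simp
  | add p q hp hq =>
    convert Ideal.add_mem _ hp hq using 1
    simp only [map_add]; ring
  | mul_X p j hp =>
    convert Ideal.add_mem _ (Ideal.mul_mem_right (X j) _ hp)
      (Ideal.mul_mem_left _ (C (eval y p)) (Ideal.subset_span ⟨j, rfl⟩ :
        X j - C (y j) ∈ pointIdeal y)) using 1
    simp only [map_mul, eval_X]; ring

theorem MvPolynomial.mem_pointIdeal {y : σ → k} {f : MvPolynomial σ k} :
    f ∈ pointIdeal y ↔ eval y f = 0 := by
  refine ⟨fun h => ?_, fun h => by simpa [h] using sub_C_eval_mem_pointIdeal y f⟩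
  have : pointIdeal y ≤ RingHom.ker (eval y) := Ideal.span_le.2 (by rintro _ ⟨j, rfl⟩; simp)
  exact this h

theorem MvPolynomial.eval_pderiv_eq_zero_of_mem_pointIdeal_sq {y : σ → k} {q : MvPolynomial σ k}
    (hq : q ∈ pointIdeal y ^ 2) (j : σ) : eval y (pderiv j q) = 0 := by
  rw [sq] at hq
  induction hq using Submodule.mul_induction_on' with
  | mem_mul_mem a ha b hb =>
    rw [mem_pointIdeal] at ha hb
    simp [ha, hb]
  | add a _ b _ ha hb => simp [ha, hb]

/-- First order Taylor expansion. -/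
theorem MvPolynomial.sub_taylor_mem_pointIdeal_sq [Fintype σ] (y : σ → k) (f : MvPolynomial σ k) :
    f - C (eval y f) - ∑ j, C (eval y (pderiv j f)) * (X j - C (y j)) ∈ pointIdeal y ^ 2 := by
  classical
  induction f using MvPolynomial.induction_on with
  | C a => simp
  | add p q hp hq =>
    convert Ideal.add_mem _ hp hq using 1
    simp only [map_add, add_mul, Finset.sum_add_distrib]; ring
  | mul_X p i hp =>
    have h1 : (p - C (eval y p)) * (X i - C (y i)) ∈ pointIdeal y ^ 2 := by
      rw [sq]
      exact Ideal.mul_mem_mul (sub_C_eval_mem_pointIdeal y p) (Ideal.subset_span ⟨i, rfl⟩)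
    convert Ideal.add_mem _ (Ideal.mul_mem_left _ (C (y i)) hp) h1 using 1
    have h2 : ∑ j, C (eval y (pderiv j (p * X i))) * (X j - C (y j)) =
        C (y i) * ∑ j, C (eval y (pderiv j p)) * (X j - C (y j)) +
          C (eval y p) * (X i - C (y i)) := by
      rw [Finset.mul_sum, ← Finset.sum_add_sum_compl {i}ᶜ, compl_compl, Finset.sum_singleton,
        ← Finset.sum_add_sum_compl {i}ᶜ (fun j => C (y i) * _), compl_compl, Finset.sum_singleton]
      rw [Finset.sum_congr rfl (g := fun j => C (y i) * (C (eval y (pderiv j p)) *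
        (X j - C (y j))))]
      · simp only [pderiv_mul, pderiv_X_self, map_add, map_mul, eval_X, map_one]; ring
      · intro j hj
        have : i ≠ j := by simpa [eq_comm] using hj
        simp only [pderiv_mul, pderiv_X_of_ne this, mul_zero, add_zero, map_mul, eval_X]; ring
    rw [h2]
    simp only [map_mul, eval_X]; ring

variable {O : Type*} [CommRing O] [IsLocalRing O]

/-- `ψ` presents the local ring `O` as the localization at `y` of a quotient of the polynomial
ring. -/
structure MvPolynomial.IsLocalAt (ψ : MvPolynomial σ k →+* O) (y : σ → k) : Prop where
  X_sub_C_mem : ∀ j, ψ (X j) - ψ (C (y j)) ∈ maximalIdeal O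
  exists_mul_eq : ∀ a, ∃ f s, eval y s ≠ 0 ∧ a * ψ s = ψ f

namespace MvPolynomial.IsLocalAt

variable {ψ : MvPolynomial σ k →+* O} {y : σ → k}

theorem map_le (h : IsLocalAt ψ y) : (pointIdeal y).map ψ ≤ maximalIdeal O := by
  rw [pointIdeal, Ideal.map_span, Ideal.span_le]
  rintro _ ⟨_, ⟨j, rfl⟩, rfl⟩
  simpa using h.X_sub_C_mem j

theorem mem_maximalIdeal_iff (h : IsLocalAt ψ y) {f : MvPolynomial σ k} :
    ψ f ∈ maximalIdeal O ↔ eval y f = 0 := by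
  have h1 := h.map_le (Ideal.mem_map_of_mem ψ (sub_C_eval_mem_pointIdeal y f))
  rw [map_sub] at h1
  refine ⟨fun h2 => ?_, fun h2 => by simpa [h2] using h1⟩
  by_contra hne
  have h3 : ψ (C (eval y f)) ∈ maximalIdeal O := by
    simpa using (maximalIdeal O).sub_mem h2 h1
  exact (IsLocalRing.mem_maximalIdeal _).1 h3 ((isUnit_iff_ne_zero.2 hne).map (ψ.comp C))

theorem isUnit (h : IsLocalAt ψ y) {s : MvPolynomial σ k} (hs : eval y s ≠ 0) : IsUnit (ψ s) := by
  by_contra h1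
  exact hs (h.mem_maximalIdeal_iff.1 ((IsLocalRing.mem_maximalIdeal _).2 h1))

theorem maximalIdeal_eq (h : IsLocalAt ψ y) : maximalIdeal O = (pointIdeal y).map ψ := by
  refine le_antisymm (fun a ha => ?_) h.map_le
  obtain ⟨f, s, hs, hfs⟩ := h.exists_mul_eq a
  have h1 : ψ f ∈ maximalIdeal O := hfs ▸ Ideal.mul_mem_right _ _ ha
  rw [h.mem_maximalIdeal_iff, ← mem_pointIdeal] at h1
  have h2 := Ideal.mem_map_of_mem ψ h1
  rw [← hfs] at h2
  exact (Ideal.mul_unit_mem_iff_mem _ (h.isUnit hs)).1 h2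

theorem exists_mul_eq_of_mem_map (h : IsLocalAt ψ y) {J : Ideal (MvPolynomial σ k)} {a : O}
    (ha : a ∈ J.map ψ) : ∃ q ∈ J, ∃ s, eval y s ≠ 0 ∧ a * ψ s = ψ q := by
  induction ha using Submodule.span_induction with
  | mem a ha =>
    obtain ⟨q, hq, rfl⟩ := ha
    exact ⟨q, hq, 1, by simp, by simp⟩
  | zero => exact ⟨0, J.zero_mem, 1, by simp, by simp⟩
  | add a b _ _ ha hb =>
    obtain ⟨q, hq, s, hs, e⟩ := ha
    obtain ⟨r, hr, t, ht, e'⟩ := hb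
    refine ⟨q * t + r * s, J.add_mem (J.mul_mem_right _ hq) (J.mul_mem_right _ hr), s * t, ?_, ?_⟩
    · rw [map_mul]; exact mul_ne_zero hs ht
    · simp only [map_mul, map_add, ← e, ← e']; ring
  | smul r a _ ha =>
    obtain ⟨q, hq, s, hs, e⟩ := ha
    obtain ⟨f, t, ht, e'⟩ := h.exists_mul_eq r
    refine ⟨f * q, J.mul_mem_left _ hq, t * s, ?_, ?_⟩
    · rw [map_mul]; exact mul_ne_zero ht hs
    · simp only [map_mul, smul_eq_mul, ← e, ← e']; ring

/-- If the relations have vanishing partial derivatives in the directions `S`, these directions are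
independent in the cotangent space. -/
theorem card_le_spanFinrank [IsNoetherianRing O] (h : IsLocalAt ψ y) (S : Finset σ)
    (hS : ∀ g, ψ g = 0 → ∀ j ∈ S, eval y (pderiv j g) = 0) :
    S.card ≤ (maximalIdeal O).spanFinrank := by
  classical
  let _ : Algebra k O := (ψ.comp C).toAlgebra
  have hk : Function.Surjective (algebraMap k (ResidueField O)) := fun a => by
    obtain ⟨a, rfl⟩ := residue_surjective a
    obtain ⟨f, s, hs, e⟩ := h.exists_mul_eq a
    refine ⟨eval y f / eval y s, ?_⟩
    have h1 : ∀ f, residue O (ψ f) = residue O (ψ (C (eval y f))) := fun f => by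
      rw [← sub_eq_zero, ← map_sub, residue_eq_zero_iff, ← map_sub, h.mem_maximalIdeal_iff]
      simp
    have h2 := congrArg (residue O) e
    rw [map_mul, h1 s, h1 f] at h2
    have h3 : residue O (ψ (C (eval y s))) ≠ 0 := by
      rw [Ne, residue_eq_zero_iff, h.mem_maximalIdeal_iff]; simpa using hs
    have h4 : algebraMap k (ResidueField O) = (residue O).comp (ψ.comp C) := rfl
    rw [h4, map_div₀]
    exact (eq_div_of_mul_eq h3 h2).symm
  obtain ⟨_, hfr⟩ := finrank_cotangentSpace_eq hk
  rw [spanFinrank_maximalIdeal_eq_finrank_cotangentSpace, ← hfr]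
  let u : σ → maximalIdeal O := fun j => ⟨_, h.X_sub_C_mem j⟩
  have hli : LinearIndependent k fun j : S => (maximalIdeal O).toCotangent (u j) := by
    rw [Fintype.linearIndependent_iff]
    intro c hc i
    let l : MvPolynomial σ k := ∑ j : S, C (c j) * (X j.1 - C (y j))
    have hl : ψ l ∈ maximalIdeal O ^ 2 := by
      have h1 : ∑ j : S, c j • (maximalIdeal O).toCotangent (u j) =
          (maximalIdeal O).toCotangent (∑ j : S, c j • u j) := by
        rw [map_sum]
        exact Finset.sum_congr rfl fun j _ => ((maximalIdeal O).toCotangent.map_smul_of_tower _ _).symm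
      rw [h1, Ideal.toCotangent_eq_zero] at hc
      convert hc using 1
      simp only [l, map_sum, map_mul, map_sub, Submodule.coe_sum]
      rfl
    rw [h.maximalIdeal_eq, ← Ideal.map_pow] at hl
    obtain ⟨q, hq, s, hs, e⟩ := h.exists_mul_eq_of_mem_map hl
    -- Clearing denominators, `l * s - q` is a relation with `q` in the square of the ideal of `y`;
    -- its `i`-th derivative at `y` is `c i` times `s(y) ≠ 0`.
    have h2 := hS (l * s - q) (by rw [map_sub, map_mul, e, sub_self]) i i.2
    have hly : eval y l = 0 := by simp [l]
    have hld : eval y (pderiv i.1 l) = c i := by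
      simp only [l, map_sum, pderiv_mul, pderiv_C, zero_mul, zero_add, map_sub, sub_zero, map_mul,
        eval_C, pderiv_X]
      rw [Finset.sum_eq_single i]
      · simp
      · intro j _ hj
        rw [Pi.single_eq_of_ne (fun h => hj (Subtype.ext h))]; simp
      · simp
    rw [map_sub, pderiv_mul, map_sub, eval_pderiv_eq_zero_of_mem_pointIdeal_sq hq, map_add, map_mul,
      map_mul, hly, hld, zero_mul, add_zero, sub_zero] at h2
    exact (mul_eq_zero.1 h2).resolve_right hs
  simpa using hli.fintype_card_le_finrank

/-- A relation with nonzero differential lowers the embedding dimension. -/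
theorem spanFinrank_lt [IsNoetherianRing O] [Fintype σ] (h : IsLocalAt ψ y)
    {g : MvPolynomial σ k} (hg : ψ g = 0) {i : σ} (hi : eval y (pderiv i g) ≠ 0) :
    (maximalIdeal O).spanFinrank < Fintype.card σ := by
  classical
  let v : σ → O := fun j => ψ (X j - C (y j))
  have hv : ∀ j, v j ∈ maximalIdeal O := fun j => by
    simpa [v] using h.X_sub_C_mem j
  let N := Ideal.span (v '' {i}ᶜ)
  -- The Taylor expansion of `g` expresses `X i - y i` modulo `𝔪²` through the other coordinates, as
  -- `∂ᵢg(y)` is a unit. By Nakayama this generator is superfluous.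
  have hle : maximalIdeal O ≤ N ⊔ maximalIdeal O • maximalIdeal O := by
    rw [smul_eq_mul, ← sq]
    nth_rw 1 [h.maximalIdeal_eq]
    rw [pointIdeal, Ideal.map_span, Ideal.span_le]
    rintro _ ⟨_, ⟨j, rfl⟩, rfl⟩
    have hN : ∀ j ≠ i, v j ∈ N := fun j hj => Ideal.subset_span ⟨j, hj, rfl⟩
    by_cases hj : j = i
    · subst hj
      have h1 := Ideal.mem_map_of_mem ψ (sub_taylor_mem_pointIdeal_sq y g)
      rw [Ideal.map_pow, ← h.maximalIdeal_eq, map_sub, map_sub, hg,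
        h.mem_maximalIdeal_iff.1 (hg ▸ (maximalIdeal O).zero_mem), map_zero, map_zero, sub_zero,
        zero_sub, Ideal.neg_mem_iff, map_sum, ← Finset.add_sum_erase _ _ (Finset.mem_univ j)] at h1
      have h2 : ∑ x ∈ Finset.univ.erase j, ψ (C (eval y (pderiv x g)) * (X x - C (y x))) ∈ N :=
        Ideal.sum_mem _ fun x hx => by
          rw [map_mul]; exact Ideal.mul_mem_left _ _ (hN x (Finset.ne_of_mem_erase hx))
      have h3 := Ideal.sub_mem _ (Ideal.mem_sup_right h1 : _ ∈ N ⊔ maximalIdeal O ^ 2)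
        (Ideal.mem_sup_left h2)
      rw [add_sub_cancel_right, map_mul] at h3
      exact (Ideal.unit_mul_mem_iff_mem _ ((isUnit_iff_ne_zero.2 hi).map (ψ.comp C))).1 h3
    · exact Ideal.mem_sup_left (hN j hj)
  have hmN : maximalIdeal O = N := le_antisymm
    (Submodule.le_of_le_smul_of_le_jacobson_bot (IsNoetherian.noetherian _)
      (maximalIdeal_le_jacobson _) hle)
    (Ideal.span_le.2 (by rintro _ ⟨j, -, rfl⟩; exact hv j))
  rw [hmN]
  refine (Submodule.spanFinrank_span_le_ncard_of_finite (Set.toFinite _)).trans_lt ?_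
  refine (Set.ncard_image_le (Set.toFinite _)).trans_lt ?_
  rw [Set.ncard_compl, Set.ncard_singleton, Nat.card_eq_fintype_card]
  have : 0 < Fintype.card σ := Fintype.card_pos_iff.2 ⟨i⟩
  omega

end MvPolynomial.IsLocalAt

end Jacobian

/-! ### A dimension bound from a nontrivial relation -/

section KrullDim

/-- A local ring whose elements are fractions of elements of the image of a domain of dimension `d`
under a noninjective map has dimension less than `d`. -/
theorem ringKrullDim_add_one_le_of_exists_mul_eq {O A : Type*} [CommRing O]
    [CommRing A] [IsDomain A] (ψ : A →+* O) (hψ : ∀ a, ∃ f s, IsUnit (ψ s) ∧ a * ψ s = ψ f)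
    {g : A} (hg : ψ g = 0) (hg0 : g ≠ 0) : ringKrullDim O + 1 ≤ ringKrullDim A := by
  refine le_trans ?_ (ringKrullDim_quotient_succ_le_of_nonZeroDivisor
    (mem_nonZeroDivisors_of_ne_zero hg0))
  gcongr
  let χ : A ⧸ Ideal.span {g} →+* O := Ideal.Quotient.lift _ ψ fun a ha => by
    obtain ⟨b, rfl⟩ := Ideal.mem_span_singleton'.1 ha
    rw [map_mul, hg, mul_zero]
  refine Order.krullDim_le_of_strictMono (PrimeSpectrum.comap χ)
    (Monotone.strictMono_of_injective (fun p q hpq => Ideal.comap_mono hpq) fun p q hpq => ?_)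
  -- Every element of `O` is, up to a unit, in the image of `ψ`, so a prime of `O` is determined by
  -- its contraction to `A ⧸ (g)`.
  have key : ∀ p q : PrimeSpectrum O, PrimeSpectrum.comap χ p = PrimeSpectrum.comap χ q →
      p.asIdeal ≤ q.asIdeal := fun p q hpq a ha => by
    obtain ⟨f, s, hs, e⟩ := hψ a
    have h1 : Ideal.Quotient.mk _ f ∈ (PrimeSpectrum.comap χ p).asIdeal := by
      change ψ f ∈ p.asIdeal
      exact e ▸ Ideal.mul_mem_right _ _ ha
    rw [hpq] at h1
    have h2 : ψ f ∈ q.asIdeal := h1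
    rw [← e] at h2
    exact (Ideal.mul_unit_mem_iff_mem _ hs).1 h2
  exact PrimeSpectrum.ext (le_antisymm (key p q hpq) (key q p hpq.symm))

end KrullDim

/-! ### Degree zero fractions as germs and sections over `Proj` -/

section ProjSections

open IsLocalRing HomogeneousLocalization

variable {A σ : Type u} [CommRing A] [SetLike σ A] [AddSubgroupClass σ A] (𝒜 : ℕ → σ) [GradedRing 𝒜]

instance AlgebraicGeometry.Proj.isPrime_asHomogeneousIdeal (x : Proj 𝒜) :
    x.asHomogeneousIdeal.toIdeal.IsPrime :=
  ProjectiveSpectrum.isPrime x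

/-- Degree zero fractions as elements of the stalks of a scheme over `Proj`. -/
noncomputable def AlgebraicGeometry.Proj.stalkEval {Z : Scheme.{u}} (i : Z ⟶ Proj 𝒜) (w : Z) :
    AtPrime 𝒜 (i w).asHomogeneousIdeal.toIdeal →+* Z.presheaf.stalk w :=
  ((Proj.stalkIso 𝒜 (i w)).inv ≫ i.stalkMap w).hom

/-- Degree zero fractions as sections of a scheme over `Proj`. -/
noncomputable def AlgebraicGeometry.Proj.awayEval {Z : Scheme.{u}} (i : Z ⟶ Proj 𝒜) (f : A) :
    Away 𝒜 f →+* Γ(Z, i ⁻¹ᵁ Proj.basicOpen 𝒜 f) :=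
  (Proj.awayToSection 𝒜 f ≫ i.app (Proj.basicOpen 𝒜 f)).hom

variable {𝒜} {Z : Scheme.{u}} (i : Z ⟶ Proj 𝒜)

theorem AlgebraicGeometry.Proj.germ_awayEval {f : A} {w : Z}
    (hw : f ∈ (i w).asHomogeneousIdeal.toIdeal.primeCompl) (b : Away 𝒜 f) :
    Z.presheaf.germ (i ⁻¹ᵁ Proj.basicOpen 𝒜 f) w hw (Proj.awayEval 𝒜 i f b) =
      Proj.stalkEval 𝒜 i w (mapId 𝒜 (Submonoid.powers_le.mpr hw) b) := by
  have h1 := ProjectiveSpectrum.Proj.awayToSection_germ 𝒜 f (i w) hw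
  have h2 := i.germ_stalkMap (Proj.basicOpen 𝒜 f) w hw
  have h3 : Proj.awayToSection 𝒜 f ≫ (Proj 𝒜).presheaf.germ _ (i w) hw =
      CommRingCat.ofHom (mapId 𝒜 (Submonoid.powers_le.mpr hw)) ≫ (Proj.stalkIso 𝒜 (i w)).inv := h1
  have h4 : (Proj.awayToSection 𝒜 f ≫ i.app (Proj.basicOpen 𝒜 f)) ≫
      Z.presheaf.germ (i ⁻¹ᵁ Proj.basicOpen 𝒜 f) w hw =
      CommRingCat.ofHom (mapId 𝒜 (Submonoid.powers_le.mpr hw)) ≫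
        (Proj.stalkIso 𝒜 (i w)).inv ≫ i.stalkMap w := by
    rw [Category.assoc, ← h2, reassoc_of% h3]
  exact congrArg (fun t : CommRingCat.of (Away 𝒜 f) ⟶ Z.presheaf.stalk w => t.hom b) h4

/-- Stalk maps are local, so they preserve and reflect units, and a fraction in the localization at
a prime is a unit exactly when its numerator avoids the prime. -/
theorem AlgebraicGeometry.Proj.stalkEval_mk_mem_iff (w : Z)
    (c : NumDenSameDeg 𝒜 (i w).asHomogeneousIdeal.toIdeal.primeCompl) :
    Proj.stalkEval 𝒜 i w (mk c) ∈ maximalIdeal (Z.presheaf.stalk w) ↔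
      (c.num : A) ∈ (i w).asHomogeneousIdeal.toIdeal := by
  have h1 : IsUnit (Proj.stalkEval 𝒜 i w (mk c)) ↔ IsUnit (mk c) :=
    (isUnit_map_iff (i.stalkMap w).hom _).trans
      (MulEquiv.isUnit_map (Proj.stalkIso 𝒜 (i w)).symm.commRingCatIsoToRingEquiv)
  rw [mem_maximalIdeal, mem_nonunits_iff, h1, ← isUnit_iff_isUnit_val, val_mk,
    Localization.mk_eq_mk', IsLocalization.AtPrime.isUnit_mk'_iff _
    (i w).asHomogeneousIdeal.toIdeal]
  exact not_not

/-- Sections of an integral scheme inject into the function field, where vanishing means lying in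
the maximal ideal. -/
theorem AlgebraicGeometry.Proj.awayEval_mk_eq_zero_iff [IsIntegral Z] {f : A}
    (c : NumDenSameDeg 𝒜 (Submonoid.powers f))
    (hf : f ∈ (i (genericPoint Z)).asHomogeneousIdeal.toIdeal.primeCompl) :
    Proj.awayEval 𝒜 i f (mk c) = 0 ↔
      (c.num : A) ∈ (i (genericPoint Z)).asHomogeneousIdeal.toIdeal := by
  have h1 := Proj.stalkEval_mk_mem_iff i (genericPoint Z)
    (c.map (.id 𝒜) (Submonoid.powers_le.mpr hf))
  have h2 : _ = Proj.stalkEval 𝒜 i (genericPoint Z)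
      (mk (c.map (.id 𝒜) (Submonoid.powers_le.mpr hf))) := Proj.germ_awayEval i hf (mk c)
  rw [← h2] at h1
  refine Iff.trans ?_ h1
  have h3 : maximalIdeal (Z.presheaf.stalk (genericPoint Z)) = ⊥ :=
    (isField_iff_maximalIdeal_eq).1 (Field.toIsField Z.functionField)
  exact ((map_eq_zero_iff _ (germ_injective_of_isIntegral Z _ hf)).symm.trans
    Ideal.mem_bot.symm).trans (iff_of_eq (congrArg (_ ∈ ·) h3.symm))

theorem AlgebraicGeometry.Proj.stalkEval_surjective [IsClosedImmersion i] (w : Z) :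
    Function.Surjective (Proj.stalkEval 𝒜 i w) := by
  have h1 : Function.Surjective (i.stalkMap w) := i.stalkMap_surjective w
  exact h1.comp (ConcreteCategory.bijective_of_isIso (Proj.stalkIso 𝒜 (i w)).inv).2

end ProjSections

/-! ### Rational points of projective space and dehomogenization -/

section Homogeneous

open MvPolynomial

attribute [local instance] MvPolynomial.gradedAlgebra

theorem MvPolynomial.IsHomogeneous.eval₂_mul_const {R S σ : Type*} [CommSemiring R]
    [CommSemiring S] {f : MvPolynomial σ R} {d : ℕ} (hf : f.IsHomogeneous d) (φ : R →+* S)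
    (x : σ → S) (t : S) : f.eval₂ φ (fun j => x j * t) = f.eval₂ φ x * t ^ d := by
  rw [eval₂_eq, eval₂_eq, Finset.sum_mul]
  refine Finset.sum_congr rfl fun m hm => ?_
  have h1 : ∑ j ∈ m.support, m j = d := by
    rw [← hf (mem_support_iff.1 hm), Finsupp.weight_apply, Finsupp.sum]
    simp
  simp only [mul_pow, Finset.prod_mul_distrib, Finset.prod_pow_eq_pow_sum, h1]
  ring

variable {k σ : Type*} [Field k]

/-- The restriction of polynomials to the line through `y`. -/
noncomputable def MvPolynomial.lineHom (y : σ → k) : MvPolynomial σ k →+* Polynomial k :=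
  eval₂Hom Polynomial.C fun j => Polynomial.C (y j) * Polynomial.X

theorem MvPolynomial.IsHomogeneous.lineHom_eq {f : MvPolynomial σ k} {d : ℕ}
    (hf : f.IsHomogeneous d) (y : σ → k) :
    lineHom y f = Polynomial.C (eval y f) * Polynomial.X ^ d := by
  rw [lineHom, coe_eval₂Hom, hf.eval₂_mul_const]
  congr 1
  exact (eval₂_comp_left Polynomial.C (RingHom.id k) y f).symm

theorem MvPolynomial.coeff_lineHom (y : σ → k) (f : MvPolynomial σ k) (d : ℕ) :
    (lineHom y f).coeff d = eval y (homogeneousComponent d f) := by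
  conv_lhs => rw [← sum_homogeneousComponent f]
  rw [map_sum, Polynomial.finsetSum_coeff]
  simp only [fun i => (homogeneousComponent_isHomogeneous i f).lineHom_eq y,
    Polynomial.coeff_C_mul_X_pow]
  rw [Finset.sum_ite_eq]
  split_ifs with h
  · rfl
  · rw [homogeneousComponent_eq_zero _ _ (by simpa using h), map_zero]

/-- The coefficients of the restriction to the line are the values at `y` of the homogeneous
components. The kernel is thus the homogeneous prime of the point with coordinates `y`. -/
theorem MvPolynomial.mem_ker_lineHom {y : σ → k} {f : MvPolynomial σ k} :
    f ∈ RingHom.ker (lineHom y) ↔ ∀ d, eval y (homogeneousComponent d f) = 0 := by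
  simp only [RingHom.mem_ker, Polynomial.ext_iff, coeff_lineHom, Polynomial.coeff_zero]

theorem MvPolynomial.IsHomogeneous.mem_ker_lineHom_iff {y : σ → k} {f : MvPolynomial σ k} {d : ℕ}
    (hf : f.IsHomogeneous d) : f ∈ RingHom.ker (lineHom y) ↔ eval y f = 0 := by
  rw [RingHom.mem_ker, hf.lineHom_eq]
  simp

theorem MvPolynomial.isHomogeneous_ker_lineHom (y : σ → k) :
    (RingHom.ker (lineHom y)).IsHomogeneous (homogeneousSubmodule σ k) := by
  intro d f hf
  have h1 : (DirectSum.decompose (homogeneousSubmodule σ k) f d : MvPolynomial σ k) =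
      homogeneousComponent d f := decomposition.decompose'_apply f d
  rw [h1, (homogeneousComponent_isHomogeneous d f).mem_ker_lineHom_iff]
  exact mem_ker_lineHom.1 hf d

/-- The point of projective space with homogeneous coordinates `y`. -/
noncomputable def ProjectiveSpectrum.ofPoint (y : σ → k) (hy : y ≠ 0) :
    ProjectiveSpectrum (homogeneousSubmodule σ k) where
  asHomogeneousIdeal := ⟨RingHom.ker (lineHom y), isHomogeneous_ker_lineHom y⟩
  isPrime := RingHom.ker_isPrime _
  not_irrelevant_le h := by
    obtain ⟨j, hj⟩ := Function.ne_iff.1 hy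
    refine hj ?_
    have h1 : (X j : MvPolynomial σ k) ∈ RingHom.ker (lineHom y) :=
      h (HomogeneousIdeal.mem_irrelevant_of_mem _ one_pos (isHomogeneous_X k j))
    simpa using (isHomogeneous_X k j).mem_ker_lineHom_iff.1 h1

theorem ProjectiveSpectrum.mem_ofPoint {y : σ → k} (hy : y ≠ 0) {f : MvPolynomial σ k} {d : ℕ}
    (hf : f.IsHomogeneous d) :
    f ∈ (ofPoint y hy).asHomogeneousIdeal.toIdeal ↔ eval y f = 0 :=
  hf.mem_ker_lineHom_iff

theorem MvPolynomial.exists_isHomogeneous_one_eval_eq_one {y : σ → k} (hy : y ≠ 0) :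
    ∃ L : MvPolynomial σ k, L.IsHomogeneous 1 ∧ eval y L = 1 := by
  obtain ⟨j, hj⟩ := Function.ne_iff.1 hy
  exact ⟨C (y j)⁻¹ * X j, (isHomogeneous_X k j).C_mul _, by simpa using inv_mul_cancel₀ hj⟩

/-- Modulo the ideal of the point, a form `f` of degree `d` equals `f(y) L ^ d`. A strictly larger
prime contains a power of `L`, hence `L`, hence the irrelevant ideal. -/
theorem ProjectiveSpectrum.eq_ofPoint_of_le {y : σ → k} (hy : y ≠ 0)
    {q : ProjectiveSpectrum (homogeneousSubmodule σ k)} (hq : ofPoint y hy ≤ q) :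
    q = ofPoint y hy := by
  refine le_antisymm ?_ hq
  by_contra hle
  obtain ⟨L, hL, hL1⟩ := exists_isHomogeneous_one_eval_eq_one hy
  have key : ∀ {d} {f : MvPolynomial σ k}, f.IsHomogeneous d →
      f - C (eval y f) * L ^ d ∈ q.asHomogeneousIdeal.toIdeal := fun {d f} hf => by
    refine hq ((mem_ofPoint hy (hf.sub ?_)).2 (by simp [hL1]))
    simpa using (hL.pow d).C_mul (eval y f)
  have hLq : L ∈ q.asHomogeneousIdeal.toIdeal := by
    obtain ⟨f, hf, hfy⟩ := SetLike.not_le_iff_exists.1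
      (show ¬ q.asHomogeneousIdeal.toIdeal ≤ (ofPoint y hy).asHomogeneousIdeal.toIdeal from hle)
    have h1 : ∃ d, eval y (homogeneousComponent d f) ≠ 0 := by
      by_contra! h
      exact hfy (mem_ker_lineHom.2 h)
    obtain ⟨d, hd⟩ := h1
    have h2 := key (homogeneousComponent_isHomogeneous d f)
    have h3 := homogeneousComponent_mem_of_mem q.asHomogeneousIdeal.isHomogeneous hf d
    have h4 := sub_mem h3 h2
    rw [sub_sub_cancel] at h4
    refine q.isPrime.mem_of_pow_mem d ?_
    have h5 := Ideal.mul_mem_left _ (C (eval y (homogeneousComponent d f))⁻¹) h4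
    rwa [← mul_assoc, ← C_mul, inv_mul_cancel₀ hd, C_1, one_mul] at h5
  refine q.not_irrelevant_le (HomogeneousIdeal.irrelevant_le _ |>.2 fun d hd f hf => ?_)
  have h6 := key (f := f) hf
  exact (Submodule.sub_mem_iff_left _ (Ideal.mul_mem_left _ _ (Ideal.pow_mem_of_mem _ hLq d hd))).1 h6

theorem ProjectiveSpectrum.isClosed_ofPoint {y : σ → k} (hy : y ≠ 0) :
    IsClosed ({ofPoint y hy} : Set (ProjectiveSpectrum (homogeneousSubmodule σ k))) := by
  rw [← closure_subset_iff_isClosed]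
  intro q hq
  exact eq_ofPoint_of_le hy ((le_iff_mem_closure _ _ _).2 hq)

theorem MvPolynomial.X_mem_homogeneousSubmodule (j : σ) :
    (X j : MvPolynomial σ k) ∈ homogeneousSubmodule σ k (1 • 1) :=
  isHomogeneous_X k j

open HomogeneousLocalization in
/-- Dehomogenization with respect to a linear form. -/
noncomputable def MvPolynomial.dehomogenize {L : MvPolynomial σ k}
    (hL : L ∈ homogeneousSubmodule σ k 1) :
    MvPolynomial σ k →+* Away (homogeneousSubmodule σ k) L :=
  eval₂Hom ((algebraMap (homogeneousSubmodule σ k 0) _).comp (algebraMap k _))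
    fun j => Away.mk _ hL 1 (X j) (X_mem_homogeneousSubmodule j)

open HomogeneousLocalization in
theorem MvPolynomial.dehomogenize_eq {L : MvPolynomial σ k} (hL : L ∈ homogeneousSubmodule σ k 1)
    {f : MvPolynomial σ k} {d : ℕ} (hf : f ∈ homogeneousSubmodule σ k (d • 1)) :
    dehomogenize hL f = Away.mk _ hL d f hf := by
  refine val_injective _ ?_
  rw [Away.val_mk, Localization.mk_eq_mk', IsLocalization.eq_mk'_iff_mul_eq]
  have hf' : f.IsHomogeneous d := by simpa using hf
  have h1 := (hf'.eval₂_mul_const ((algebraMap (MvPolynomial σ k) (Localization (Submonoid.powers L))).comp C)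
    (fun j => (Away.mk _ hL 1 (X j) (X_mem_homogeneousSubmodule j)).val) (algebraMap _ _ L))
  rw [map_pow]
  have h2 : (dehomogenize hL f).val =
      f.eval₂ ((algebraMap (MvPolynomial σ k) (Localization (Submonoid.powers L))).comp C)
        (fun j => (Away.mk _ hL 1 (X j) (X_mem_homogeneousSubmodule j)).val) := by
    have := eval₂_comp_left (algebraMap (Away (homogeneousSubmodule σ k) L)
      (Localization (Submonoid.powers L)))
      ((algebraMap (homogeneousSubmodule σ k 0) (Away (homogeneousSubmodule σ k) L)).comp
        (algebraMap k _)) (fun j => Away.mk _ hL 1 (X j) (X_mem_homogeneousSubmodule j)) f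
    refine this.trans ?_
    rfl
  rw [h2, ← h1]
  have h3 : (fun j => (Away.mk (homogeneousSubmodule σ k) hL 1 (X j) (X_mem_homogeneousSubmodule j)).val *
      algebraMap _ (Localization (Submonoid.powers L)) L) =
      fun j => algebraMap (MvPolynomial σ k) (Localization (Submonoid.powers L)) (X j) := by
    funext j
    rw [Away.val_mk, Localization.mk_eq_mk']
    simp
  rw [h3]
  exact ((eval₂_comp_left _ C X f).symm.trans (by rw [eval₂_eta]))

end Homogeneous

/-! ### Regularity on a chart gives a homogeneous equation with nonzero differential -/

section RegularCone

open MvPolynomial IsLocalRing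

variable {k σ : Type*} [Field k]

/-- The substitution of a constant for the variable `j₀`. -/
noncomputable def MvPolynomial.substConst (j₀ : σ) (c : k) :
    MvPolynomial σ k →+* MvPolynomial {j // j ≠ j₀} k :=
  open Classical in eval₂Hom C fun j => if h : j ≠ j₀ then X ⟨j, h⟩ else C c

theorem MvPolynomial.map_rename_substConst {O : Type*} [CommSemiring O]
    {ψ : MvPolynomial σ k →+* O} {j₀ : σ} {c : k} (h : ψ (X j₀) = ψ (C c)) (f : MvPolynomial σ k) :
    ψ (rename Subtype.val (substConst j₀ c f)) = ψ f := by
  suffices (ψ.comp (rename (Subtype.val : {j // j ≠ j₀} → σ) :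
      MvPolynomial {j // j ≠ j₀} k →ₐ[k] MvPolynomial σ k).toRingHom).comp (substConst j₀ c) = ψ from
    RingHom.congr_fun this f
  refine MvPolynomial.ringHom_ext (fun a => ?_) fun j => ?_
  · simp [substConst]
  · by_cases hj : j = j₀
    · subst hj; simp [substConst, h]
    · simp [substConst, hj]

theorem MvPolynomial.eval_substConst {j₀ : σ} {c : k} {x : σ → k} (hx : x j₀ = c)
    (f : MvPolynomial σ k) : eval (fun j => x j.1) (substConst j₀ c f) = eval x f := by
  rw [← map_rename_substConst (ψ := eval x) (j₀ := j₀) (c := c) (by simp [hx]), eval_rename]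
  rfl

/-- If the substitution kills `f`, rescaling shows that `f` vanishes wherever `x j₀ ≠ 0`; then `X j₀
* f` vanishes everywhere, so it is zero over an infinite field. -/
theorem MvPolynomial.IsHomogeneous.substConst_ne_zero [Infinite k] {f : MvPolynomial σ k} {d : ℕ}
    (hf : f.IsHomogeneous d) (hf0 : f ≠ 0) (j₀ : σ) {c : k} (hc : c ≠ 0) :
    substConst j₀ c f ≠ 0 := by
  intro h
  refine mul_ne_zero (X_ne_zero (R := k) j₀) hf0 (MvPolynomial.funext fun x => ?_)
  rw [map_mul, eval_X, map_zero]
  by_cases hx : x j₀ = 0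
  · rw [hx, zero_mul]
  · have h1 := hf.eval₂_mul_const (RingHom.id k) x ((x j₀)⁻¹ * c)
    have h2 := eval_substConst (c := c) (x := fun j => x j * ((x j₀)⁻¹ * c))
      (mul_inv_cancel_left₀ hx c) f
    rw [h, map_zero] at h2
    have h3 : eval x f * ((x j₀)⁻¹ * c) ^ d = 0 := h1.symm.trans h2.symm
    rw [(mul_eq_zero.1 h3).resolve_right (pow_ne_zero _ (mul_ne_zero (inv_ne_zero hx) hc)),
      mul_zero]

variable {O : Type*} [CommRing O] {ψ : MvPolynomial σ k →+* O} {y : σ → k}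

/-- If a polynomial vanishes on a chart `x j₀ = y j₀`, so does its homogenization, which has the same
derivatives at `y` along the chart. -/
theorem MvPolynomial.exists_isHomogeneous_eval_pderiv_eq {j₀ : σ} (hy : y j₀ ≠ 0)
    (hj : ψ (X j₀) = ψ (C (y j₀))) (f : MvPolynomial σ k) :
    ∃ d F, F.IsHomogeneous d ∧ ψ F = ψ f ∧
      ∀ j ≠ j₀, eval y (pderiv j F) = eval y (pderiv j f) := by
  let L : MvPolynomial σ k := C (y j₀)⁻¹ * X j₀
  have hL : L.IsHomogeneous 1 := (isHomogeneous_X k j₀).C_mul _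
  have hψL : ψ L = 1 := by
    rw [map_mul, hj, ← map_mul, ← C_mul, inv_mul_cancel₀ hy, C_1, map_one]
  have hyL : eval y L = 1 := by simpa [L] using inv_mul_cancel₀ hy
  -- Components are padded by powers of `L`, which is `1` at `y` and under `ψ`, and has zero
  -- derivative in the directions `j ≠ j₀`.
  refine ⟨f.totalDegree, ∑ d ∈ Finset.range (f.totalDegree + 1),
    homogeneousComponent d f * L ^ (f.totalDegree - d), ?_, ?_, fun j hjne => ?_⟩
  · refine IsHomogeneous.sum _ _ _ fun d hd => ?_
    have h1 := (homogeneousComponent_isHomogeneous d f).mul (hL.pow (f.totalDegree - d))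
    rw [one_mul] at h1
    rwa [Nat.add_sub_cancel' (Nat.lt_succ_iff.1 (Finset.mem_range.1 hd))] at h1
  · conv_rhs => rw [← sum_homogeneousComponent f]
    simp [hψL]
  · have hjL : pderiv j L = 0 := by simp [L, pderiv_X_of_ne hjne.symm]
    conv_rhs => rw [← sum_homogeneousComponent f]
    simp [hjL, hyL]

/-- Let `n` be the number of variables. If all these derivatives vanished, the `n - 1` chart
coordinates would be independent in the cotangent space. The relation `f₀`, nonzero on the chart,
forces dimension at most `n - 2`, contradicting regularity. -/
theorem MvPolynomial.IsLocalAt.exists_eval_pderiv_ne_zero [Infinite k] [Fintype σ]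
    [IsRegularLocalRing O] (h : IsLocalAt ψ y) {j₀ : σ} (hy : y j₀ ≠ 0)
    (hj : ψ (X j₀) = ψ (C (y j₀))) {f₀ : MvPolynomial σ k} {d₀ : ℕ} (hf₀ : f₀.IsHomogeneous d₀)
    (hψf₀ : ψ f₀ = 0) (hne : f₀ ≠ 0) :
    ∃ d g, g.IsHomogeneous d ∧ ψ g = 0 ∧ ∃ j, eval y (pderiv j g) ≠ 0 := by
  classical
  by_contra! hcon
  have h1 := h.card_le_spanFinrank (Finset.univ.erase j₀) fun f hf j hjm => by
    obtain ⟨d, F, hF, hψF, hd⟩ := exists_isHomogeneous_eval_pderiv_eq hy hj f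
    rw [← hd j (Finset.ne_of_mem_erase hjm)]
    exact hcon d F hF (hψF.trans hf) j
  rw [Finset.card_erase_of_mem (Finset.mem_univ _), Finset.card_univ] at h1
  let ψ' : MvPolynomial {j // j ≠ j₀} k →+* O := ψ.comp (rename Subtype.val).toRingHom
  have hψ' : ∀ f, ψ' (substConst j₀ (y j₀) f) = ψ f := map_rename_substConst hj
  have h2 := ringKrullDim_add_one_le_of_exists_mul_eq ψ' (fun a => by
    obtain ⟨f, s, hs, e⟩ := h.exists_mul_eq a
    exact ⟨substConst j₀ (y j₀) f, substConst j₀ (y j₀) s, (hψ' s).symm ▸ h.isUnit hs,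
      by rw [hψ', hψ', e]⟩)
    ((hψ' f₀).trans hψf₀) (hf₀.substConst_ne_zero hne j₀ hy)
  rw [ringKrullDim_of_isNoetherianRing, ringKrullDim_eq_zero_of_field, zero_add,
    ← IsRegularLocalRing.spanFinrank_maximalIdeal] at h2
  rw [Nat.card_eq_fintype_card, Fintype.card_subtype_compl, Fintype.card_subtype_eq] at h2
  norm_cast at h2
  omega

end RegularCone

/-! ### Local rings of projective varieties in homogeneous coordinates -/

section ProjLocal

open IsLocalRing HomogeneousLocalization MvPolynomial

attribute [local instance] MvPolynomial.gradedAlgebra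

variable {k : Type u} [Field k] {n : ℕ} {Z : Scheme.{u}}
  (i : Z ⟶ Proj (homogeneousSubmodule (Fin n) k)) {L : MvPolynomial (Fin n) k}
  (hL : L ∈ homogeneousSubmodule (Fin n) k 1)

/-- Polynomials as germs at `w`, through dehomogenization with respect to `L`. -/
noncomputable def AlgebraicGeometry.Proj.polyEval (w : Z)
    (hw : L ∈ (i w).asHomogeneousIdeal.toIdeal.primeCompl) :
    MvPolynomial (Fin n) k →+* Z.presheaf.stalk w :=
  (Proj.stalkEval _ i w).comp ((mapId _ (Submonoid.powers_le.mpr hw)).comp (dehomogenize hL))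

variable {i} {w : Z} (hw : L ∈ (i w).asHomogeneousIdeal.toIdeal.primeCompl)

theorem AlgebraicGeometry.Proj.polyEval_mem_iff {f : MvPolynomial (Fin n) k} {d : ℕ}
    (hf : f.IsHomogeneous d) :
    Proj.polyEval i hL w hw f ∈ maximalIdeal (Z.presheaf.stalk w) ↔
      f ∈ (i w).asHomogeneousIdeal.toIdeal := by
  have hf' : f ∈ homogeneousSubmodule (Fin n) k (d • 1) := by simpa using hf
  have h1 := Proj.stalkEval_mk_mem_iff i w
    ⟨d • 1, ⟨f, hf'⟩, ⟨L ^ d, SetLike.pow_mem_graded d hL⟩, pow_mem hw d⟩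
  rw [← h1, Proj.polyEval, RingHom.comp_apply, RingHom.comp_apply, dehomogenize_eq hL hf']
  rfl

theorem AlgebraicGeometry.Proj.polyEval_eq_zero_iff [IsIntegral Z] {f : MvPolynomial (Fin n) k}
    {d : ℕ} (hf : f.IsHomogeneous d)
    (hη : L ∈ (i (genericPoint Z)).asHomogeneousIdeal.toIdeal.primeCompl) :
    Proj.polyEval i hL w hw f = 0 ↔ f ∈ (i (genericPoint Z)).asHomogeneousIdeal.toIdeal := by
  have hf' : f ∈ homogeneousSubmodule (Fin n) k (d • 1) := by simpa using hf
  have h1 := Proj.awayEval_mk_eq_zero_iff i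
    ⟨d • 1, ⟨f, hf'⟩, ⟨L ^ d, SetLike.pow_mem_graded d hL⟩, ⟨d, rfl⟩⟩ hη
  refine Iff.trans ?_ h1
  rw [Proj.polyEval, RingHom.comp_apply, RingHom.comp_apply, ← Proj.germ_awayEval i hw,
    dehomogenize_eq hL hf']
  exact map_eq_zero_iff _ (germ_injective_of_isIntegral Z _ hw)

theorem AlgebraicGeometry.Proj.polyEval_self : Proj.polyEval i hL w hw L = 1 := by
  rw [Proj.polyEval, RingHom.comp_apply, RingHom.comp_apply, dehomogenize_eq hL (d := 1) hL]
  suffices Away.mk _ hL 1 L hL = 1 by rw [this, map_one, map_one]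
  refine val_injective _ ?_
  rw [Away.val_mk, val_one, Localization.mk_eq_mk', IsLocalization.mk'_eq_iff_eq_mul]
  simp

/-- The form `X j - y j * L` vanishes at `y` while `L` maps to `1`; and since a closed immersion is
surjective on stalks, every germ is a quotient of two forms of equal degree. -/
theorem AlgebraicGeometry.Proj.isLocalAt_polyEval [IsClosedImmersion i] {y : Fin n → k} (hy : y ≠ 0)
    (hiw : i w = ProjectiveSpectrum.ofPoint y hy) (hLy : eval y L = 1) :
    IsLocalAt (Proj.polyEval i hL w hw) y where
  X_sub_C_mem j := by
    have h1 : (X j - C (y j) * L : MvPolynomial (Fin n) k).IsHomogeneous 1 :=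
      (isHomogeneous_X k j).sub (IsHomogeneous.C_mul hL _)
    have h2 := (Proj.polyEval_mem_iff hL hw h1).2 (by
      rw [hiw, ProjectiveSpectrum.mem_ofPoint hy h1]; simp [hLy])
    rwa [map_sub, map_mul, Proj.polyEval_self, mul_one] at h2
  exists_mul_eq a := by
    obtain ⟨b, rfl⟩ := Proj.stalkEval_surjective i w a
    obtain ⟨c, rfl⟩ := mk_surjective b
    have hn : (c.num : MvPolynomial (Fin n) k) ∈ homogeneousSubmodule (Fin n) k (c.deg • 1) := by simp
    have hd : (c.den : MvPolynomial (Fin n) k) ∈ homogeneousSubmodule (Fin n) k (c.deg • 1) := by simp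
    refine ⟨c.num, c.den, fun h => ?_, ?_⟩
    · have h1 : c.den.1 ∈ (i w).asHomogeneousIdeal.toIdeal ↔ eval y c.den.1 = 0 :=
        (iff_of_eq (congrArg (fun q : ProjectiveSpectrum (homogeneousSubmodule (Fin n) k) =>
          c.den.1 ∈ q.asHomogeneousIdeal.toIdeal) hiw)).trans
            (ProjectiveSpectrum.mem_ofPoint hy c.den.2)
      exact c.den_mem (h1.2 h)
    · rw [Proj.polyEval, RingHom.comp_apply, RingHom.comp_apply, RingHom.comp_apply,
        RingHom.comp_apply, dehomogenize_eq hL hn, dehomogenize_eq hL hd, ← map_mul]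
      refine congrArg _ (val_injective _ ?_)
      rw [val_mul, val_mk]
      refine (Localization.mk_mul _ _ _ _).trans ?_
      refine Localization.mk_eq_mk_iff.2 (Localization.r_of_eq ?_)
      change L ^ c.deg * (c.num.1 * c.den.1) = c.den.1 * L ^ c.deg * c.num.1
      ring

/-- Every point of `Z` specializes the generic point, so its prime contains the generic one. -/
theorem AlgebraicGeometry.Proj.vanishingIdeal_range [IsIntegral Z] :
    ProjectiveSpectrum.vanishingIdeal (Set.range fun z => (i z : ProjectiveSpectrum _)) =
      (i (genericPoint Z)).asHomogeneousIdeal := by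
  refine le_antisymm (fun f hf => ?_) fun f hf => ?_
  · exact (ProjectiveSpectrum.mem_vanishingIdeal _ _).1 hf _ ⟨_, rfl⟩
  · refine (ProjectiveSpectrum.mem_vanishingIdeal _ _).2 ?_
    rintro _ ⟨z, rfl⟩
    have h1 : genericPoint Z ⤳ z := genericPoint_specializes z
    have h2 := h1.map i.continuous
    have h3 := (ProjectiveSpectrum.le_iff_mem_closure _ _ _).2 h2.mem_closure
    exact h3 hf

/-- The Jacobian criterion for the affine cone over a smooth projective variety. -/
theorem AlgebraicGeometry.Proj.exists_eval_pderiv_ne_zero [IsIntegral Z] [IsClosedImmersion i]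
    [Infinite k]
    (hreg : ∀ z : Z, IsClosed ({z} : Set Z) → IsRegularLocalRing (Z.presheaf.stalk z))
    (hsurj : ¬ Function.Surjective i) {y : Fin n → k} (hy : y ≠ 0)
    (hIy : ∀ f ∈ (i (genericPoint Z)).asHomogeneousIdeal.toIdeal, eval y f = 0) :
    ∃ g ∈ (i (genericPoint Z)).asHomogeneousIdeal.toIdeal, ∃ j, eval y (pderiv j g) ≠ 0 := by
  have hcl : IsClosed (Set.range i) := i.isClosedEmbedding.isClosed_range
  have hclos : ProjectiveSpectrum.zeroLocus _
      ((i (genericPoint Z)).asHomogeneousIdeal : Set (MvPolynomial (Fin n) k)) = Set.range i :=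
    (congrArg (fun I : HomogeneousIdeal (homogeneousSubmodule (Fin n) k) =>
      ProjectiveSpectrum.zeroLocus _ (I : Set (MvPolynomial (Fin n) k)))
      Proj.vanishingIdeal_range.symm).trans
      ((ProjectiveSpectrum.zeroLocus_vanishingIdeal_eq_closure _ _).trans hcl.closure_eq)
  have hle : (i (genericPoint Z)).asHomogeneousIdeal.toIdeal ≤
      (ProjectiveSpectrum.ofPoint y hy).asHomogeneousIdeal.toIdeal := fun f hf =>
    mem_ker_lineHom.2 fun d => hIy _
      (homogeneousComponent_mem_of_mem (HomogeneousIdeal.isHomogeneous _) hf d)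
  -- The image of `Z` is closed, hence the zero locus of its ideal, so a nonzero point of the cone
  -- comes from a point of `Z`.
  obtain ⟨w, hiw⟩ : ProjectiveSpectrum.ofPoint y hy ∈ Set.range i := hclos ▸ hle
  have hwc : IsClosed ({w} : Set Z) := by
    rw [i.isClosedEmbedding.isClosed_iff_image_isClosed, Set.image_singleton, hiw]
    exact ProjectiveSpectrum.isClosed_ofPoint hy
  have := hreg w hwc
  -- Were the ideal zero, its zero locus, the image of `Z`, would be the whole projective space.
  obtain ⟨f₀, hf₀, hne⟩ : ∃ f ∈ (i (genericPoint Z)).asHomogeneousIdeal.toIdeal, f ≠ 0 := by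
    by_contra! h
    refine hsurj (Set.range_eq_univ.1 (Set.eq_univ_of_forall fun q => ?_))
    rw [← hclos]
    intro f hf
    rw [h f hf]
    exact zero_mem _
  obtain ⟨d, hd⟩ : ∃ d, homogeneousComponent d f₀ ≠ 0 := by
    by_contra! h
    exact hne (by rw [← sum_homogeneousComponent f₀]; simp [h])
  obtain ⟨j₀, hj₀⟩ := Function.ne_iff.1 hy
  have hL : (C (y j₀)⁻¹ * X j₀ : MvPolynomial (Fin n) k) ∈ homogeneousSubmodule (Fin n) k 1 :=
    (isHomogeneous_X k j₀).C_mul _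
  have hLy : eval y (C (y j₀)⁻¹ * X j₀) = 1 := by simpa using inv_mul_cancel₀ hj₀
  have hw : (C (y j₀)⁻¹ * X j₀ : MvPolynomial (Fin n) k) ∈
      (i w).asHomogeneousIdeal.toIdeal.primeCompl := fun h => by
    rw [hiw] at h
    rw [(ProjectiveSpectrum.mem_ofPoint hy hL).1 h] at hLy
    exact zero_ne_one hLy
  have hη : (C (y j₀)⁻¹ * X j₀ : MvPolynomial (Fin n) k) ∈
      (i (genericPoint Z)).asHomogeneousIdeal.toIdeal.primeCompl := fun h => by
    rw [hIy _ h] at hLy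
    exact zero_ne_one hLy
  have hj : Proj.polyEval i hL w hw (X j₀) = Proj.polyEval i hL w hw (C (y j₀)) := by
    have h1 := congrArg (Proj.polyEval i hL w hw (C (y j₀)) * ·) (Proj.polyEval_self hL hw)
    simp only [mul_one] at h1
    rwa [← map_mul, ← mul_assoc, ← C_mul, mul_inv_cancel₀ hj₀, C_1, one_mul] at h1
  obtain ⟨e, g, hg, hψg, j, hne⟩ :=
    (Proj.isLocalAt_polyEval hL hw hy hiw hLy).exists_eval_pderiv_ne_zero hj₀ hj
      (homogeneousComponent_isHomogeneous d f₀)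
      ((Proj.polyEval_eq_zero_iff hL hw (homogeneousComponent_isHomogeneous d f₀) hη).2
        (homogeneousComponent_mem_of_mem (HomogeneousIdeal.isHomogeneous _) hf₀ d)) hd
  exact ⟨g, (Proj.polyEval_eq_zero_iff hL hw hg hη).1 hψg, j, hne⟩

end ProjLocal

/-! ### Localizations of quotients of polynomial rings -/

section LocalQuotient

open MvPolynomial IsLocalRing

variable {k σ : Type*} [Field k] {I : Ideal (MvPolynomial σ k)} {O : Type*} [CommRing O]
  [Algebra (MvPolynomial σ k ⧸ I) O]

theorem MvPolynomial.isLocalAt_algebraMap_comp_mk [IsLocalRing O]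
    (m : Ideal (MvPolynomial σ k ⧸ I)) [m.IsPrime] [IsLocalization.AtPrime O m] {y : σ → k}
    (hm : ∀ f, Ideal.Quotient.mk I f ∈ m ↔ eval y f = 0) :
    IsLocalAt ((algebraMap (MvPolynomial σ k ⧸ I) O).comp (Ideal.Quotient.mk I)) y where
  X_sub_C_mem j := by
    rw [← map_sub, RingHom.comp_apply, IsLocalization.AtPrime.to_map_mem_maximal_iff O m, hm]
    simp
  exists_mul_eq a := by
    obtain ⟨⟨f, s⟩, hfs⟩ := IsLocalization.surj m.primeCompl a
    obtain ⟨f, rfl⟩ := Ideal.Quotient.mk_surjective f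
    obtain ⟨s', hs'⟩ := Ideal.Quotient.mk_surjective s.1
    refine ⟨f, s', fun h => s.2 (hs' ▸ (hm s').2 h), ?_⟩
    rw [RingHom.comp_apply, hs']
    exact hfs

theorem MvPolynomial.algebraMap_comp_mk_eq_zero_iff [I.IsPrime]
    (m : Ideal (MvPolynomial σ k ⧸ I)) [m.IsPrime] [IsLocalization.AtPrime O m]
    {f : MvPolynomial σ k} :
    (algebraMap (MvPolynomial σ k ⧸ I) O).comp (Ideal.Quotient.mk I) f = 0 ↔ f ∈ I := by
  rw [RingHom.comp_apply, map_eq_zero_iff _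
    (IsLocalization.injective O m.primeCompl_le_nonZeroDivisors), Ideal.Quotient.eq_zero_iff_mem]

end LocalQuotient

/-! ### Tangent dimensions of closed subvarieties of affine space -/

section AffineQuotient

open MvPolynomial IsLocalRing

variable {k : Type u} [Field k] {n : ℕ} (I : Ideal (MvPolynomial (Fin n) k))

/-- The closed subscheme of `𝔸ⁿ` defined by the ideal `I`. -/
noncomputable abbrev specQuotient : Over (Spec (CommRingCat.of k)) :=
  Over.mk (Spec.map (CommRingCat.ofHom (algebraMap k (MvPolynomial (Fin n) k ⧸ I))))

instance locallyOfFiniteType_specQuotient : LocallyOfFiniteType (specQuotient I).hom := by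
  change LocallyOfFiniteType (Spec.map _)
  rw [HasRingHomProperty.Spec_iff (P := @LocallyOfFiniteType)]
  exact (RingHom.finiteType_algebraMap).2 inferInstance

theorem isIrreducibleVariety_specQuotient [I.IsPrime] :
    IsIrreducibleVariety (specQuotient I) := by
  have : IsIntegral (specQuotient I).left :=
    inferInstanceAs (IsIntegral (Spec (CommRingCat.of (MvPolynomial (Fin n) k ⧸ I))))
  exact
  { isReduced := inferInstance
    isSeparated := inferInstanceAs (IsSeparated (Spec.map _))
    locallyOfFiniteType := inferInstance
    quasiCompact := inferInstanceAs (QuasiCompact (Spec.map _))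
    irreducibleSpace := inferInstance }

variable {I}

/-- The ideal of a point of the closed subscheme defined by `I`. -/
def Pt.ideal (x : Pt (specQuotient I)) : Ideal (MvPolynomial (Fin n) k ⧸ I) :=
  PrimeSpectrum.asIdeal x.1

theorem Pt.ideal_injective : Function.Injective (Pt.ideal (I := I)) := fun _ _ h =>
  Subtype.ext (PrimeSpectrum.ext h)

theorem Pt.isMaximal_ideal (x : Pt (specQuotient I)) : x.ideal.IsMaximal :=
  (PrimeSpectrum.isClosed_singleton_iff_isMaximal _).1 x.2

theorem Pt.exists_mk_mem_ideal_iff [IsAlgClosed k] (x : Pt (specQuotient I)) :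
    ∃ y : Fin n → k, ∀ f, Ideal.Quotient.mk I f ∈ x.ideal ↔ eval y f = 0 := by
  have := x.isMaximal_ideal
  have h1 : (x.ideal.comap (Ideal.Quotient.mk I)).IsMaximal :=
    Ideal.comap_isMaximal_of_surjective _ Ideal.Quotient.mk_surjective
  obtain ⟨y, hy⟩ := (isMaximal_iff_eq_vanishingIdeal_singleton (K := k)).1 h1
  refine ⟨y, fun f => ?_⟩
  rw [← Ideal.mem_comap, hy, mem_vanishingIdeal_singleton_iff]
  simp [aeval_eq_eval]

theorem Pt.exists_isLocalAt [I.IsPrime] (x : Pt (specQuotient I)) {y : Fin n → k}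
    (hy : ∀ f, Ideal.Quotient.mk I f ∈ x.ideal ↔ eval y f = 0) :
    ∃ ψ : MvPolynomial (Fin n) k →+* x.localRing, IsLocalAt ψ y ∧ ∀ f, ψ f = 0 ↔ f ∈ I := by
  have : x.ideal.IsPrime := x.isMaximal_ideal.isPrime
  let _ : Algebra (MvPolynomial (Fin n) k ⧸ I) x.localRing :=
    StructureSheaf.stalkAlgebra (MvPolynomial (Fin n) k ⧸ I) x.1
  have : IsLocalization.AtPrime x.localRing x.ideal :=
    StructureSheaf.IsLocalization.to_stalk (MvPolynomial (Fin n) k ⧸ I) x.1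
  exact ⟨_, isLocalAt_algebraMap_comp_mk x.ideal hy,
    fun f => algebraMap_comp_mk_eq_zero_iff x.ideal⟩

theorem Pt.tangentDim_lt [I.IsPrime] (x : Pt (specQuotient I)) {y : Fin n → k}
    (hy : ∀ f, Ideal.Quotient.mk I f ∈ x.ideal ↔ eval y f = 0) {g : MvPolynomial (Fin n) k}
    (hg : g ∈ I) {j : Fin n} (hj : eval y (pderiv j g) ≠ 0) : x.tangentDim < n := by
  obtain ⟨ψ, hψ, hI⟩ := x.exists_isLocalAt hy
  have := isNoetherianRing_localRing x
  rw [x.tangentDim_eq_spanFinrank]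
  simpa using hψ.spanFinrank_lt ((hI g).2 hg) hj

theorem Pt.le_tangentDim [I.IsPrime] (x : Pt (specQuotient I)) {y : Fin n → k}
    (hy : ∀ f, Ideal.Quotient.mk I f ∈ x.ideal ↔ eval y f = 0)
    (hI : ∀ g ∈ I, ∀ j, eval y (pderiv j g) = 0) : n ≤ x.tangentDim := by
  obtain ⟨ψ, hψ, hψI⟩ := x.exists_isLocalAt hy
  have := isNoetherianRing_localRing x
  rw [x.tangentDim_eq_spanFinrank]
  simpa using hψ.card_le_spanFinrank Finset.univ fun g hg j _ => hI g ((hψI g).1 hg) j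

theorem Pt.exists_of_forall_eval_eq_zero {y : Fin n → k} (hy : ∀ f ∈ I, eval y f = 0) :
    ∃ x : Pt (specQuotient I), ∀ f, Ideal.Quotient.mk I f ∈ x.ideal ↔ eval y f = 0 := by
  let ev : MvPolynomial (Fin n) k ⧸ I →+* k := Ideal.Quotient.lift I (eval y) hy
  have hev : (RingHom.ker ev).IsMaximal := RingHom.ker_isMaximal_of_surjective ev fun c =>
    ⟨Ideal.Quotient.mk I (C c), by simp [ev]⟩
  exact ⟨⟨⟨RingHom.ker ev, hev.isPrime⟩,
    (PrimeSpectrum.isClosed_singleton_iff_isMaximal _).2 hev⟩, fun f => by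
      change ev _ = 0 ↔ _
      simp [ev]⟩

/-- The tangent dimension is at least `n` at the origin and less than `n` elsewhere. -/
theorem Pt.subsingleton_isVertex [IsAlgClosed k] [I.IsPrime]
    (h0 : ∀ f ∈ I, eval 0 f = 0) (hd : ∀ g ∈ I, ∀ j, eval 0 (pderiv j g) = 0)
    (hne : ∀ y ≠ 0, (∀ f ∈ I, eval y f = 0) → ∃ g ∈ I, ∃ j, eval y (pderiv j g) ≠ 0) :
    {x : Pt (specQuotient I) | x.IsVertex}.Subsingleton := by
  obtain ⟨o, ho⟩ := Pt.exists_of_forall_eval_eq_zero h0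
  have key : ∀ x : Pt (specQuotient I), x.IsVertex → x = o := fun x hx => by
    obtain ⟨y, hy⟩ := x.exists_mk_mem_ideal_iff
    have hyI : ∀ f ∈ I, eval y f = 0 := fun f hf => by
      rw [← hy, Ideal.Quotient.eq_zero_iff_mem.2 hf]
      exact zero_mem _
    by_cases hy0 : y = 0
    · subst hy0
      refine Pt.ideal_injective (Ideal.ext fun f => ?_)
      obtain ⟨f, rfl⟩ := Ideal.Quotient.mk_surjective f
      rw [hy, ho]
    · obtain ⟨g, hg, j, hj⟩ := hne y hy0 hyI
      have h1 := x.tangentDim_lt hy hg hj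
      have h2 := o.le_tangentDim ho hd
      exact absurd (hx o) (by omega)
  exact fun x hx y hy => (key x hx).trans (key y hy).symm

end AffineQuotient

/-! ### The affine cone and the final statement -/

section Cone

open MvPolynomial

attribute [local instance] MvPolynomial.gradedAlgebra

theorem MvPolynomial.eval_zero_pderiv {k σ : Type*} [CommSemiring k] (f : MvPolynomial σ k)
    (j : σ) : eval 0 (pderiv j f) = coeff (Finsupp.single j 1) f := by
  rw [eval_zero, constantCoeff_eq, coeff_pderiv]
  simp

variable {k : Type u} [Field k] {n : ℕ}

theorem ProjectiveSpectrum.eval_zero_of_mem (q : ProjectiveSpectrum (homogeneousSubmodule (Fin n) k))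
    {f : MvPolynomial (Fin n) k} (hf : f ∈ q.asHomogeneousIdeal.toIdeal) : eval 0 f = 0 := by
  by_contra h
  have h1 := homogeneousComponent_mem_of_mem (HomogeneousIdeal.isHomogeneous _) hf 0
  rw [homogeneousComponent_zero, ← constantCoeff_eq, ← eval_zero] at h1
  exact q.isPrime.ne_top (Ideal.eq_top_of_isUnit_mem _ h1 ((isUnit_iff_ne_zero.2 h).map C))

/-- The ideal is homogeneous, so the linear component of `g` also vanishes on `Z` and cuts out the
hyperplane. -/
theorem LiesInHyperplane.of_mem_vanishingIdeal {Z : Over (Spec (CommRingCat.of k))}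
    (i : Z ⟶ projSpace k n) {g : MvPolynomial (Fin n) k}
    (hg : g ∈ (ProjectiveSpectrum.vanishingIdeal (projImage i)).toIdeal)
    (hg1 : homogeneousComponent 1 g ≠ 0) : LiesInHyperplane i := by
  refine ⟨_, homogeneousComponent_isHomogeneous 1 g, hg1, ?_⟩
  intro q hq
  refine Set.singleton_subset_iff.2 ?_
  exact (ProjectiveSpectrum.mem_vanishingIdeal _ _).1
    (homogeneousComponent_mem_of_mem (HomogeneousIdeal.isHomogeneous _) hg 1) q hq

theorem isJordanGroup_aut_affineCone [IsAlgClosed k] [CharZero k]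
    {Z : Over (Spec (CommRingCat.of k))} (i : Z ⟶ projSpace k n) (hZ : IsIrreducibleVariety Z)
    (hreg : IsSmoothVariety Z) (hi : IsClosedImmersion i.left)
    (hsurj : ¬ Function.Surjective i.left) (hlin : ¬ LiesInHyperplane i) :
    IsJordanGroup (Aut (affineCone i)) := by
  have := hZ.isReduced
  have := hZ.irreducibleSpace
  have : IsIntegral Z.left := isIntegral_of_irreducibleSpace_of_isReduced _
  let j : Z.left ⟶ Proj (homogeneousSubmodule (Fin n) k) := i.left
  have : IsClosedImmersion j := hi
  have hI : ProjectiveSpectrum.vanishingIdeal (projImage i) =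
      (j (genericPoint Z.left)).asHomogeneousIdeal := Proj.vanishingIdeal_range (i := j)
  have hp : (ProjectiveSpectrum.vanishingIdeal (projImage i)).toIdeal.IsPrime :=
    hI ▸ ProjectiveSpectrum.isPrime (j (genericPoint Z.left))
  refine isJordanGroup_aut_of_finite_isVertex
    (X := specQuotient (ProjectiveSpectrum.vanishingIdeal (projImage i)).toIdeal)
    (isIrreducibleVariety_specQuotient _)
    (Pt.subsingleton_isVertex (fun f hf => ?_) (fun g hg l => ?_) fun y hy hIy => ?_).finite
  · rw [hI] at hf
    exact ProjectiveSpectrum.eval_zero_of_mem _ hf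
  -- The derivatives at the origin are the linear coefficients, and a nonzero one would put `Z` in a
  -- hyperplane.
  · rw [eval_zero_pderiv]
    by_contra h
    refine hlin (.of_mem_vanishingIdeal i hg fun h0 => h ?_)
    have h1 := congrArg (coeff (Finsupp.single l 1)) h0
    rwa [coeff_homogeneousComponent, if_pos (by simp), coeff_zero] at h1
  · rw [hI] at hIy ⊢
    exact Proj.exists_eval_pderiv_ne_zero (i := j) (fun z hz => hreg ⟨z, hz⟩) hsurj hy hIy

end Cone

theorem mainTheorem6 {k : Type u} [Field k] [IsAlgClosed k] [CharZero k] :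
    (∀ X : Over (Spec (CommRingCat.of k)), IsIrreducibleVariety X →
      ∀ r : Setoid (Pt X), IsAutStable X r →
      ∀ C : Set (Pt X), C ∈ r.classes → C.Finite →
        IsJordanGroup (Aut X) ∧
        ∃ m : ℕ, IsGreatest (Set.range fun x : Pt X => x.tangentDim) m ∧
          jordanConst (Aut X) ≤
            C.ncard.factorial * jordanConst (GL (Fin m) k) ^ C.ncard.factorial) ∧
    (∀ X : Over (Spec (CommRingCat.of k)), IsIrreducibleVariety X →
      (∃ x : Pt X, {y : Pt X | LocalRingsIso x y}.Finite) →
        IsJordanGroup (Aut X)) ∧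
    (∀ X : Over (Spec (CommRingCat.of k)), IsIrreducibleVariety X →
      {x : Pt X | x.IsVertex}.Finite →
        IsJordanGroup (Aut X)) ∧
    (∀ X : Over (Spec (CommRingCat.of k)), IsIrreducibleVariety X →
      ¬ IsSmoothVariety X → {x : Pt X | x.IsSingular}.Finite →
        IsJordanGroup (Aut X)) ∧
    (∀ (n : ℕ) (Z : Over (Spec (CommRingCat.of k))) (i : Z ⟶ projSpace k n),
      IsIrreducibleVariety Z → IsSmoothVariety Z →
      IsClosedImmersion i.left → ¬ Function.Surjective i.left →
      ¬ LiesInHyperplane i →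
        IsJordanGroup (Aut (affineCone i))) :=
  ⟨fun _ hX _ hr _ hC hfin => isJordanGroup_aut_of_finite_class hX hr hC hfin,
    fun _ hX ⟨x, hx⟩ => isJordanGroup_aut_of_finite_localRingsIso hX x hx,
    fun _ hX h => isJordanGroup_aut_of_finite_isVertex hX h,
    fun _ hX hns h => isJordanGroup_aut_of_finite_isSingular hX hns h,
    fun _ _ i hZ hreg hi hsurj hlin => isJordanGroup_aut_affineCone i hZ hreg hi hsurj hlin⟩
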